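/- Let $1\le d\le N$ be integers and $a\in\mathbb{R}$, and write $\mathbf a=(a,\dots,a)\in\mathbb{R}^N$. **The operators.** For a function $\phi$ of $N$ real variables $x_1,\dots,x_N$ and a point whose coordinates are all distinct, put $$\hat D_d\phi=\binom{N}{d}^{-1}\sum_{I\subseteq\{1,\dots,N\},\ |I|=d}\ \sum_{i\in I}\frac{\partial\phi/\partial x_i}{\prod_{j\in I,\ j\ne i}(x_j-x_i)} .$$ **The dual coordinates.** For $0\le h\le N$ let $\tilde e_h=\frac{(N-h)!}{N!}e_h$, where $e_h$ is the $h$th elementary symmetric polynomial in $x_1,\dots,x_N$, and for $1\le r\le N$ let $$\hat u_r=\frac{N!}{(N-r)!}\sum_{\lambda\vdash r}(-1)^{l(\lambda)-1}\frac{(l(\lambda)-1)!}{\prod_{h=1}^{r} m_h!}\prod_{h=1}^{r}\tilde e_h^{\,m_h},\qquad \hat u=(\hat u_1,\dots,\hat u_N),$$ where $m_h$ is the multiplicity of $h$ in the partition $\lambda$ and $l(\lambda)=\sum_h m_h$. **Value at $\mathbf a$.** We say that $\hat D_d\phi$ has the value $v$ at $\mathbf a$ if * $\hat D_d\phi(x)\to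 v$ as $x\to\mathbf a$ through the points with distinct coordinates, and * whenever $\phi=\psi\circ\hat u$ on $\mathbb{R}^N$ for a function $\psi$ on $\mathbb{R}^N$ that is continuously differentiable around $\hat u(\mathbf a)$, the partial derivative of $\psi$ with respect to its $d$th variable at $\hat u(\mathbf a)$ is $v$. **Derivatives at $\mathbf a$.** For a symmetric function $\phi$ that is $C^d$ around $\mathbf a$ and a partition $\sigma=(h_1,\dots,h_l)$ of $d$, let $\partial^\sigma\phi(\mathbf a)$ be the value at $\mathbf a$ of $\partial_{i_1}^{h_1}\cdots\partial_{i_l}^{h_l}\phi$ for distinct indices $i_1,\dots,i_l$, and let $$\partial^d_{\mathbb{N}_N}\phi(\mathbf a)=\sum_{\sigma\vdash d}(-1)^{d-l(\sigma)}\frac{d\cdot(l(\sigma)-1)!}{\prod_{h=1}^{d}h!^{\,m_h}m_h!}\,\partial^\sigma\phi(\mathbf a),$$ where $m_h$ is the multiplicity of $h$ in $\sigma$ and $l(\sigma)=\sum_h m_h$. **Claim.** 1. For every symmetric function $\phi:\mathbb{R}^N\to\mathbb{R}$ that is $C^d$ around $\mathbf a$, each $\partial^\sigma\phi(\mathbf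 a)$ is independent of the choice of the distinct indices $i_1,\dots,i_l$, and $\hat D_d\phi$ has the value $\partial^d_{\mathbb{N}_N}\phi(\mathbf a)$ at $\mathbf a$. 2. For every $f:\mathbb{R}\to\mathbb{R}$ that is $C^d$ around $a$, and for the trace function $\phi(x_1,\dots,x_N)=\sum_{i=1}^N f(x_i)$, the value of $\hat D_d\phi$ at $\mathbf a$ is $\dfrac{(-1)^{d-1}}{(d-1)!}f^{(d)}(a)$. -/

import Mathlib

open Filter Topology

noncomputable section

namespace SymmDeriv

/-- The partial derivative `∂ᵢ φ = ∂φ/∂xᵢ` of a function of `N` real variables. -/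
def pderiv {N : ℕ} (i : Fin N) (φ : (Fin N → ℝ) → ℝ) : (Fin N → ℝ) → ℝ :=
  fun x => lineDeriv ℝ φ x (Pi.single i 1)

/-- The mixed partial derivative `(∏ᵢ ∂ᵢ ^ hᵢ) φ` with multiplicities `h`. -/
def mixedPderiv {N : ℕ} (h : Fin N → ℕ) (φ : (Fin N → ℝ) → ℝ) : (Fin N → ℝ) → ℝ :=
  (List.finRange N).foldr (fun i g => (pderiv i)^[h i] g) φ

/-- `φ` is a symmetric function of its `N` variables. -/
def IsSymm {N : ℕ} (φ : (Fin N → ℝ) → ℝ) : Prop :=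
  ∀ (s : Equiv.Perm (Fin N)) (x : Fin N → ℝ), φ (x ∘ s) = φ x

/-- The trace function `(x₁, …, x_N) ↦ ∑ᵢ f (xᵢ)`. -/
def traceFun (N : ℕ) (f : ℝ → ℝ) : (Fin N → ℝ) → ℝ := fun x => ∑ i, f (x i)

/-- The point of the total diagonal all of whose coordinates equal `a`. -/
def diagPt (N : ℕ) (a : ℝ) : Fin N → ℝ := fun _ => a

/-- The points all of whose coordinates are distinct. -/
def distinctPts (N : ℕ) : Set (Fin N → ℝ) := {x | Function.Injective x}

/-! ### The operators `D_I`, `D_d` and their normalization -/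

/-- `D_I φ = ∑_{i ∈ I} ∂ᵢ φ / ∏_{j ∈ I, j ≠ i} (xⱼ - xᵢ)`; meaningful at points with distinct
coordinates. -/
def opSet {N : ℕ} (I : Finset (Fin N)) (φ : (Fin N → ℝ) → ℝ) : (Fin N → ℝ) → ℝ :=
  fun x => ∑ i ∈ I, pderiv i φ x / ∏ j ∈ I.erase i, (x j - x i)

/-- `D_d = d! ∑_{|I| = d} D_I`. -/
def opD {N : ℕ} (d : ℕ) (φ : (Fin N → ℝ) → ℝ) : (Fin N → ℝ) → ℝ :=
  fun x => (d.factorial : ℝ) * ∑ I ∈ (Finset.univ : Finset (Fin N)).powersetCard d, opSet I φ x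

/-- The normalized operator `((N - d)! / N!) D_d`, used for `d ≤ N`. -/
def opDhat {N : ℕ} (d : ℕ) (φ : (Fin N → ℝ) → ℝ) : (Fin N → ℝ) → ℝ :=
  fun x => (((N - d).factorial : ℝ) / (N.factorial : ℝ)) * opD d φ x

/-! ### The derivatives `∂^σ φ` and `∂^d φ` along the total diagonal -/

/-- The multiplicities `h` realize the partition `σ`: the non-zero ones among the `hᵢ` are
exactly the parts of `σ`. -/
def Realizes {N d : ℕ} (h : Fin N → ℕ) (σ : d.Partition) : Prop :=
  ((Finset.univ : Finset (Fin N)).val.map h).filter (· ≠ 0) = σ.parts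

/-- The multiplicities that assign the parts of `σ`, in decreasing order, to the first
variables (every part is used as soon as `d ≤ N`). -/
def stdMult (N : ℕ) {d : ℕ} (σ : d.Partition) : Fin N → ℕ :=
  fun i => (σ.parts.sort (· ≥ ·)).getD i 0

/-- `∂^σ φ`: the parts of `σ` are distributed as orders of differentiation among distinct
variables. -/
def partitionDeriv {N d : ℕ} (σ : d.Partition) (φ : (Fin N → ℝ) → ℝ) : (Fin N → ℝ) → ℝ :=
  mixedPderiv (stdMult N σ) φ

/-- The coefficient `(-1)^(d - l(σ)) d (l(σ) - 1)! / ∏_{h=1}^d (h!^{m_h} m_h!)`, where `l(σ)` is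
the number of parts of `σ` and `m_h` is the multiplicity of `h` in `σ`. -/
def partitionCoeff {d : ℕ} (σ : d.Partition) : ℝ :=
  (-1) ^ (d - σ.parts.card) * (d : ℝ) * ((σ.parts.card - 1).factorial : ℝ) /
    ∏ h ∈ Finset.Icc 1 d, ((h.factorial : ℝ) ^ σ.parts.count h * ((σ.parts.count h).factorial : ℝ))

/-- `∂^d φ = ∑_{σ ⊢ d} c_σ ∂^σ φ`, with all the `N` variables as the set of indices. -/
def diagDeriv {N : ℕ} (d : ℕ) (φ : (Fin N → ℝ) → ℝ) : (Fin N → ℝ) → ℝ :=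
  fun x => ∑ σ : d.Partition, partitionCoeff σ * partitionDeriv σ φ x

/-! ### The coordinates `u_r` and their normalization -/

/-- The normalized elementary symmetric function `((N - h)! / N!) e_h`, used for `h ≤ N`. -/
def eTilde {N : ℕ} (h : ℕ) (x : Fin N → ℝ) : ℝ :=
  ((N - h).factorial : ℝ) / (N.factorial : ℝ) * MvPolynomial.eval x (MvPolynomial.esymm (Fin N) ℝ h)

/-- `u_r = ∑_{λ ⊢ r} (-1)^(l(λ) - 1) (l(λ) - 1)! / ∏_{h=1}^r m_h! * ∏_{h ∈ λ} ẽ_h`. -/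
def coordU {N : ℕ} (r : ℕ) (x : Fin N → ℝ) : ℝ :=
  ∑ l : r.Partition,
    (-1) ^ (l.parts.card - 1) * ((l.parts.card - 1).factorial : ℝ) /
      (∏ h ∈ Finset.Icc 1 r, ((l.parts.count h).factorial : ℝ)) *
      (l.parts.map fun h => eTilde h x).prod

/-- The normalized coordinate `(N! / (N - r)!) u_r`, used for `r ≤ N`. -/
def coordUhat {N : ℕ} (r : ℕ) (x : Fin N → ℝ) : ℝ :=
  ((N.factorial : ℝ) / ((N - r).factorial : ℝ)) * coordU r x

/-- The vector of the `N` normalized coordinates; the entry with (zero-based) index `k` is the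
coordinate of degree `k + 1`. -/
def coordMap (N : ℕ) (x : Fin N → ℝ) : Fin N → ℝ := fun k => coordUhat (k + 1) x

/-- `v` is the value at `p` of the normalized operator of order `d` applied to `φ`: it is the limit
of the values at the points with distinct coordinates, where the operator is defined, and it is
the derivative with respect to the `d`th normalized coordinate of every function `ψ`,
continuously differentiable around the image of `p`, that expresses `φ` in these coordinates. -/
def HasValueAt {N : ℕ} (d : ℕ) (φ : (Fin N → ℝ) → ℝ) (p : Fin N → ℝ) (v : ℝ) : Prop :=
  Tendsto (opDhat d φ) (𝓝[distinctPts N] p) (𝓝 v) ∧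
  ∀ ψ : (Fin N → ℝ) → ℝ, ContDiffAt ℝ 1 ψ (coordMap N p) → (∀ x, φ x = ψ (coordMap N x)) →
    ∀ k : Fin N, (k : ℕ) + 1 = d → pderiv k ψ (coordMap N p) = v

end SymmDeriv

end

noncomputable section

namespace SymmDeriv

/-! Fix `I` with `|I| = d`. By partial fractions the operators `D_I` obey the recursion of divided
differences, and on a symmetric function the two operators being subtracted are exchanged by a
transposition of the variables. Hadamard's integral formula then divides out `x_j - x_i` at the cost
of one derivative. Hence `D_I φ` extends continuously to the diagonal point, and the limit is `0` as
soon as all derivatives of order exactly `d` vanish there (`exists_contDiff_eq_opSet`,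
`tendsto_opSet_zero`). The limit is therefore a linear function of the vector of the `∂^σ φ`, `σ ⊢
d`.

It remains to evaluate it on enough test functions. For `φ = ∏ exp (P (x_i))` with `deg P ≤ d`, `D_I
φ` is, up to sign, `φ` times the divided difference of `P'` at `d` points, that is, its coefficient
of degree `d - 1` (`opSet_expTrace`). The numbers `∂^σ φ` are then monomials in free parameters.
Distinct monomials are linearly independent, so these vectors span (`isGoodJet_all`), and the
formula holds for every `φ` (`tendsto_opSet_diagDeriv`).

For the dual coordinates, `D_I` is a derivation and `û` comes from the logarithm of the generating
function of the `ẽ_h`. Consequently `D_I û_r` tends to `1` if `r = d` and to `0` otherwise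
(`tendsto_opSet_coordUhat`). The chain rule and uniqueness of limits identify the limit with the
partial derivative of `ψ`. For a trace function only the partition with one part contributes. -/

variable {N : ℕ}

/-! ### Calculus of iterated partial derivatives. -/

theorem pderiv_eq_fderiv {φ : (Fin N → ℝ) → ℝ} {x : Fin N → ℝ} (h : DifferentiableAt ℝ φ x)
    (i : Fin N) : pderiv i φ x = fderiv ℝ φ x (Pi.single i 1) :=
  h.lineDeriv_eq_fderiv

theorem fderiv_eq_sum_pderiv {φ : (Fin N → ℝ) → ℝ} {x : Fin N → ℝ}
    (h : DifferentiableAt ℝ φ x) :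
    fderiv ℝ φ x = ∑ i, pderiv i φ x • ContinuousLinearMap.proj (R := ℝ) (φ := fun _ => ℝ) i := by
  ext v
  conv_lhs => rw [← Finset.univ_sum_single v]
  rw [map_sum, sum_apply]
  refine Finset.sum_congr rfl fun i _ => ?_
  rw [pderiv_eq_fderiv h]
  have : Pi.single i (v i) = v i • (Pi.single i 1 : Fin N → ℝ) := by
    rw [← Pi.single_smul, smul_eq_mul, mul_one]
  rw [this, map_smul]
  simp [mul_comm]

theorem contDiff_pderiv {φ : (Fin N → ℝ) → ℝ} {n : ℕ} (h : ContDiff ℝ ((n + 1 : ℕ) : WithTop ℕ∞) φ)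
    (i : Fin N) : ContDiff ℝ n (pderiv i φ) := by
  have h1 : pderiv i φ = fun x => fderiv ℝ φ x (Pi.single i 1) := by
    ext x
    exact pderiv_eq_fderiv (h.differentiable (by simp) x) i
  rw [h1]
  exact (h.fderiv_right (m := n) (by push_cast; exact le_rfl)).clm_apply contDiff_const

theorem contDiff_succ_of_pderiv {φ : (Fin N → ℝ) → ℝ} {n : ℕ} (h : Differentiable ℝ φ)
    (h' : ∀ i, ContDiff ℝ n (pderiv i φ)) : ContDiff ℝ ((n + 1 : ℕ) : WithTop ℕ∞) φ := by
  push_cast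
  rw [contDiff_succ_iff_fderiv]
  refine ⟨h, by simp, ?_⟩
  have h1 : fderiv ℝ φ = fun x =>
      ∑ i, pderiv i φ x • ContinuousLinearMap.proj (R := ℝ) (φ := fun _ => ℝ) i := by
    ext1 x
    exact fderiv_eq_sum_pderiv (h x)
  rw [h1]
  exact ContDiff.sum fun i _ => (h' i).smul contDiff_const

theorem pderiv_comm {φ : (Fin N → ℝ) → ℝ} (h : ContDiff ℝ 2 φ) (i j : Fin N) :
    pderiv i (pderiv j φ) = pderiv j (pderiv i φ) := by
  have hd : Differentiable ℝ φ := h.differentiable (by simp)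
  have h1 : ∀ i, pderiv i φ = fun x => fderiv ℝ φ x (Pi.single i 1) := fun i => by
    ext x
    exact pderiv_eq_fderiv (hd x) i
  have h2 : Differentiable ℝ (fderiv ℝ φ) :=
    (h.fderiv_right (m := 1) (by norm_num)).differentiable (by simp)
  have h3 : ∀ i j x, pderiv i (pderiv j φ) x =
      fderiv ℝ (fderiv ℝ φ) x (Pi.single i 1) (Pi.single j 1) := fun i j x => by
    rw [h1 j, pderiv_eq_fderiv ((h2 x).clm_apply (differentiableAt_const _)),
      fderiv_clm_apply (h2 x) (differentiableAt_const _)]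
    simp
  ext x
  rw [h3, h3]
  exact (h.contDiffAt.isSymmSndFDerivAt (by simp)) _ _

theorem pderiv_comp_perm (s : Equiv.Perm (Fin N)) (φ : (Fin N → ℝ) → ℝ) (i : Fin N)
    (x : Fin N → ℝ) :
    pderiv (s i) (fun y => φ (y ∘ s)) x = pderiv i φ (x ∘ s) := by
  have h : (Pi.single (s i) (1 : ℝ) : Fin N → ℝ) ∘ s = Pi.single i 1 := by
    ext k
    simp [Pi.single_apply]
  simp only [pderiv, lineDeriv]
  congr 1
  ext t
  rw [← h]
  rfl

theorem IsSymm.comp_perm {φ : (Fin N → ℝ) → ℝ} (h : IsSymm φ) (s : Equiv.Perm (Fin N)) :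
    (fun x => φ (x ∘ s)) = φ :=
  funext fun x => h s x

theorem IsSymm.pderiv_apply {φ : (Fin N → ℝ) → ℝ} (h : IsSymm φ) (s : Equiv.Perm (Fin N))
    (i : Fin N) (x : Fin N → ℝ) : pderiv (s i) φ x = pderiv i φ (x ∘ s) := by
  rw [← pderiv_comp_perm, h.comp_perm]

theorem pderiv_congr {φ ψ : (Fin N → ℝ) → ℝ} {p : Fin N → ℝ} (h : φ =ᶠ[𝓝 p] ψ) (i : Fin N) :
    pderiv i φ =ᶠ[𝓝 p] pderiv i ψ := by
  filter_upwards [h.eventuallyEq_nhds] with x hx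
  exact hx.lineDeriv_eq

/-- The partial derivative of `φ` along a list of variables. -/
def listDeriv (l : List (Fin N)) (φ : (Fin N → ℝ) → ℝ) : (Fin N → ℝ) → ℝ :=
  l.foldr pderiv φ

@[simp] theorem listDeriv_nil (φ : (Fin N → ℝ) → ℝ) : listDeriv [] φ = φ := rfl

@[simp] theorem listDeriv_cons (i : Fin N) (l : List (Fin N)) (φ : (Fin N → ℝ) → ℝ) :
    listDeriv (i :: l) φ = pderiv i (listDeriv l φ) := rfl

theorem listDeriv_append (l l' : List (Fin N)) (φ : (Fin N → ℝ) → ℝ) :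
    listDeriv (l ++ l') φ = listDeriv l (listDeriv l' φ) :=
  List.foldr_append

theorem listDeriv_replicate (i : Fin N) (k : ℕ) (φ : (Fin N → ℝ) → ℝ) :
    listDeriv (List.replicate k i) φ = (pderiv i)^[k] φ := by
  induction k with
  | zero => rfl
  | succ k ih => rw [List.replicate_succ, listDeriv_cons, ih, Function.iterate_succ_apply']

theorem contDiff_listDeriv (l : List (Fin N)) {φ : (Fin N → ℝ) → ℝ} {n : ℕ}
    (h : ContDiff ℝ ((n + l.length : ℕ) : WithTop ℕ∞) φ) : ContDiff ℝ n (listDeriv l φ) := by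
  induction l generalizing n with
  | nil => exact h
  | cons i l ih =>
    refine contDiff_pderiv (ih ?_) i
    rwa [List.length_cons, ← add_assoc, add_right_comm] at h

theorem listDeriv_perm {l l' : List (Fin N)} (hl : l.Perm l') {φ : (Fin N → ℝ) → ℝ}
    (h : ContDiff ℝ (l.length : WithTop ℕ∞) φ) : listDeriv l φ = listDeriv l' φ := by
  induction hl with
  | nil => rfl
  | cons i _ ih =>
    rw [listDeriv_cons, listDeriv_cons, ih (h.of_le (by simp))]
  | swap i j l =>
    simp only [listDeriv_cons]
    refine pderiv_comm (contDiff_listDeriv (n := 2) l ?_) _ _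
    simpa [add_comm, add_left_comm, add_assoc, one_add_one_eq_two] using h
  | trans h1 _ ih1 ih2 =>
    rw [ih1 h, ih2 (by rwa [← h1.length_eq])]

/-- At a diagonal point `x ∘ s = x`, so relabelling the variables does not change a derivative
there. -/
theorem listDeriv_map_perm (s : Equiv.Perm (Fin N)) (l : List (Fin N)) {φ : (Fin N → ℝ) → ℝ}
    (h : IsSymm φ) (x : Fin N → ℝ) : listDeriv (l.map s) φ x = listDeriv l φ (x ∘ s) := by
  induction l generalizing x with
  | nil => exact (h s x).symm
  | cons i l ih =>
    rw [List.map_cons, listDeriv_cons, listDeriv_cons, ← pderiv_comp_perm]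
    congr 1
    ext y
    exact ih y

theorem listDeriv_congr (l : List (Fin N)) {φ ψ : (Fin N → ℝ) → ℝ} {p : Fin N → ℝ}
    (h : φ =ᶠ[𝓝 p] ψ) : listDeriv l φ =ᶠ[𝓝 p] listDeriv l ψ := by
  induction l with
  | nil => exact h
  | cons i l ih => exact pderiv_congr ih i

theorem pderiv_lin {φ ψ : (Fin N → ℝ) → ℝ} {x : Fin N → ℝ} (h : DifferentiableAt ℝ φ x)
    (h' : DifferentiableAt ℝ ψ x) (b c : ℝ) (i : Fin N) :
    pderiv i (fun y => b * φ y + c * ψ y) x = b * pderiv i φ x + c * pderiv i ψ x := by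
  rw [pderiv_eq_fderiv h, pderiv_eq_fderiv h', pderiv_eq_fderiv (by fun_prop)]
  rw [((h.hasFDerivAt.const_mul b).fun_add (h'.hasFDerivAt.const_mul c)).fderiv]
  simp

theorem listDeriv_lin (l : List (Fin N)) {φ ψ : (Fin N → ℝ) → ℝ}
    (h : ContDiff ℝ (l.length : WithTop ℕ∞) φ) (h' : ContDiff ℝ (l.length : WithTop ℕ∞) ψ)
    (b c : ℝ) :
    listDeriv l (fun y => b * φ y + c * ψ y) =
      fun y => b * listDeriv l φ y + c * listDeriv l ψ y := by
  induction l with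
  | nil => rfl
  | cons i l ih =>
    rw [listDeriv_cons, ih (h.of_le (by simp)) (h'.of_le (by simp))]
    ext x
    have e : (((i :: l).length : ℕ) : WithTop ℕ∞) = ((1 + l.length : ℕ) : WithTop ℕ∞) := by
      rw [List.length_cons, add_comm]
    rw [e] at h h'
    exact pderiv_lin ((contDiff_listDeriv (n := 1) l h).differentiable (by simp) x)
      ((contDiff_listDeriv (n := 1) l h').differentiable (by simp) x) b c i

/-! ### The operators `D_I` as divided differences. -/

/-- For `k ∈ J` this is the partial fraction `1/(AB) = (1/A - 1/B)/(B - A)` with `A = x_i - x_k`, `B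
= x_j - x_k`. The terms of index `i` and `j` each occur in only one of the two operators on the
right. -/
theorem opSet_insert_insert {i j : Fin N} {J : Finset (Fin N)} (hij : i ≠ j) (hi : i ∉ J)
    (hj : j ∉ J) (φ : (Fin N → ℝ) → ℝ) {x : Fin N → ℝ} (hx : Function.Injective x) :
    opSet (insert i (insert j J)) φ x =
      (opSet (insert i J) φ x - opSet (insert j J) φ x) / (x j - x i) := by
  have hne : ∀ k l, k ≠ l → x k - x l ≠ 0 := fun k l h => sub_ne_zero.2 (hx.ne h)
  have hi' : i ∉ insert j J := by simp [hij, hi]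
  have key : ∀ k ∈ J, pderiv k φ x / ∏ m ∈ (insert i (insert j J)).erase k, (x m - x k) =
      (pderiv k φ x / ∏ m ∈ (insert i J).erase k, (x m - x k) -
        pderiv k φ x / ∏ m ∈ (insert j J).erase k, (x m - x k)) / (x j - x i) := by
    intro k hk
    have hik : i ≠ k := fun h => hi (h ▸ hk)
    have hjk : j ≠ k := fun h => hj (h ▸ hk)
    have hP : ∏ m ∈ J.erase k, (x m - x k) ≠ 0 :=
      Finset.prod_ne_zero_iff.2 fun m hm => hne _ _ (Finset.ne_of_mem_erase hm)
    rw [Finset.erase_insert_of_ne hik, Finset.erase_insert_of_ne hjk,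
      Finset.erase_insert_of_ne hik, Finset.prod_insert, Finset.prod_insert, Finset.prod_insert]
    · have h1 := hne _ _ hik
      have h2 := hne _ _ hjk
      have h3 := hne _ _ hij.symm
      field_simp
      ring
    · simp [hi]
    · simp [hj]
    · simp [hi, hij]
  have hPi : ∏ m ∈ J, (x m - x i) ≠ 0 :=
    Finset.prod_ne_zero_iff.2 fun m hm => hne _ _ fun h => hi (h ▸ hm)
  have hPj : ∏ m ∈ J, (x m - x j) ≠ 0 :=
    Finset.prod_ne_zero_iff.2 fun m hm => hne _ _ fun h => hj (h ▸ hm)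
  simp only [opSet]
  rw [Finset.sum_insert hi', Finset.sum_insert hj, Finset.sum_insert hi, Finset.sum_insert hj,
    Finset.sum_congr rfl key, ← Finset.sum_div, Finset.sum_sub_distrib,
    Finset.erase_insert hi', Finset.erase_insert_of_ne hij, Finset.erase_insert hj,
    Finset.erase_insert hi, Finset.prod_insert hj, Finset.prod_insert hi]
  have h3 := hne _ _ hij.symm
  have h4 := hne _ _ hij
  have e : x i - x j = -(x j - x i) := by ring
  rw [e]
  field_simp
  ring

theorem IsSymm.opSet_map {φ : (Fin N → ℝ) → ℝ} (h : IsSymm φ) (s : Equiv.Perm (Fin N))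
    (I : Finset (Fin N)) (x : Fin N → ℝ) :
    opSet (I.map s.toEmbedding) φ x = opSet I φ (x ∘ s) := by
  simp only [opSet, Finset.sum_map]
  refine Finset.sum_congr rfl fun i _ => ?_
  have : (I.map s.toEmbedding).erase (s.toEmbedding i) = (I.erase i).map s.toEmbedding := by
    rw [Finset.map_erase]
  rw [this, Finset.prod_map]
  simp only [Equiv.coe_toEmbedding, Function.comp_apply]
  rw [h.pderiv_apply]

/-! ### Means over a transposition, and continuous extension to the diagonal. -/

/-- The contraction `t • id + (1 - t) • P`, with `P` the exchange of the variables `i` and `j`. -/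
def mixSwap (i j : Fin N) (t : ℝ) : (Fin N → ℝ) →L[ℝ] (Fin N → ℝ) :=
  t • ContinuousLinearMap.id ℝ (Fin N → ℝ) +
    (1 - t) • (LinearMap.toContinuousLinearMap (LinearMap.funLeft ℝ ℝ (Equiv.swap i j)))

theorem mixSwap_apply (i j : Fin N) (t : ℝ) (x : Fin N → ℝ) :
    mixSwap i j t x = t • x + (1 - t) • (x ∘ Equiv.swap i j) := rfl

theorem mixSwap_single (i j k : Fin N) (t : ℝ) :
    mixSwap i j t (Pi.single k 1) =
      t • Pi.single k 1 + (1 - t) • Pi.single (Equiv.swap i j k) 1 := by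
  rw [mixSwap_apply]
  congr 2
  ext m
  simp [Pi.single_apply, Equiv.swap_apply_eq_iff]

theorem mixSwap_diagPt (i j : Fin N) (t a : ℝ) : mixSwap i j t (diagPt N a) = diagPt N a := by
  ext k
  simp only [mixSwap_apply, diagPt, Pi.add_apply, Pi.smul_apply, Function.comp_apply, smul_eq_mul]
  ring

theorem continuous_mixSwap (i j : Fin N) : Continuous (mixSwap i j) := by
  unfold mixSwap
  fun_prop

/-- The weighted mean of `H` along the segment from `x ∘ swap i j` to `x`. -/
def swapMean (i j : Fin N) (w : ℝ → ℝ) (H : (Fin N → ℝ) → ℝ) (x : Fin N → ℝ) : ℝ :=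
  ∫ t in (0 : ℝ)..1, w t * H (mixSwap i j t x)

theorem continuous_swapMean (i j : Fin N) {w : ℝ → ℝ} (hw : Continuous w)
    {H : (Fin N → ℝ) → ℝ} (hH : Continuous H) : Continuous (swapMean i j w H) := by
  refine intervalIntegral.continuous_parametric_intervalIntegral_of_continuous' ?_ _ _
  have h := (continuous_mixSwap i j).comp (continuous_snd (X := Fin N → ℝ) (Y := ℝ))
  exact (hw.comp continuous_snd).mul (hH.comp (h.clm_apply continuous_fst))

theorem hasFDerivAt_swapMean (i j : Fin N) {w : ℝ → ℝ} (hw : Continuous w)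
    {H : (Fin N → ℝ) → ℝ} (hH : ContDiff ℝ 1 H) (x : Fin N → ℝ) :
    HasFDerivAt (swapMean i j w H)
      (∫ t in (0 : ℝ)..1, w t • (fderiv ℝ H (mixSwap i j t x)).comp (mixSwap i j t)) x := by
  have hmix : Continuous fun p : (Fin N → ℝ) × ℝ => mixSwap i j p.2 p.1 :=
    ((continuous_mixSwap i j).comp continuous_snd).clm_apply continuous_fst
  have hF' : Continuous fun p : (Fin N → ℝ) × ℝ =>
      w p.2 • (fderiv ℝ H (mixSwap i j p.2 p.1)).comp (mixSwap i j p.2) :=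
    (hw.comp continuous_snd).smul
      ((((hH.continuous_fderiv (by simp)).comp hmix)).clm_comp
        ((continuous_mixSwap i j).comp continuous_snd))
  have hF : Continuous fun p : (Fin N → ℝ) × ℝ => w p.2 * H (mixSwap i j p.2 p.1) :=
    (hw.comp continuous_snd).mul (hH.continuous.comp hmix)
  -- The derivative of the integrand is jointly continuous, so a constant dominates it near `x`,
  -- uniformly for `t` in `[0, 1]`.
  obtain ⟨C, hC⟩ := ((isCompact_closedBall x 1).prod (isCompact_Icc
    (a := (0 : ℝ)) (b := 1))).exists_bound_of_continuousOn hF'.continuousOn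
  refine intervalIntegral.hasFDerivAt_integral_of_dominated_of_fderiv_le
    (F := fun x t => w t * H (mixSwap i j t x))
    (F' := fun x t => w t • (fderiv ℝ H (mixSwap i j t x)).comp (mixSwap i j t))
    (bound := fun _ => C)
    (Metric.closedBall_mem_nhds x one_pos) ?_ ?_ ?_ ?_ ?_ ?_
  · exact Eventually.of_forall fun y =>
      (hF.comp (Continuous.prodMk_right y)).aestronglyMeasurable
  · exact (hF.comp (Continuous.prodMk_right x)).intervalIntegrable _ _
  · exact (hF'.comp (Continuous.prodMk_right x)).aestronglyMeasurable
  · refine Eventually.of_forall fun t ht y hy => hC (y, t) ⟨hy, ?_⟩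
    rw [Set.uIoc_of_le zero_le_one] at ht
    exact ⟨ht.1.le, ht.2⟩
  · exact intervalIntegrable_const
  · refine Eventually.of_forall fun t _ y _ => ?_
    exact (((hH.differentiable (by simp)) _).hasFDerivAt.comp y
      (mixSwap i j t).hasFDerivAt).const_mul (w t)

/-- Means are stable under differentiation once arbitrary continuous weights are allowed, which
makes the inductions on the order possible. The factors `1 *` give the shape that `listDeriv_lin`
rewrites. -/
theorem pderiv_swapMean (i j : Fin N) {w : ℝ → ℝ} (hw : Continuous w)
    {H : (Fin N → ℝ) → ℝ} (hH : ContDiff ℝ 1 H) (k : Fin N) :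
    pderiv k (swapMean i j w H) = fun x =>
      1 * swapMean i j (fun t => w t * t) (pderiv k H) x +
      1 * swapMean i j (fun t => w t * (1 - t)) (pderiv (Equiv.swap i j k) H) x := by
  ext x
  have hmix : Continuous fun t => mixSwap i j t x :=
    (continuous_mixSwap i j).clm_apply continuous_const
  have hc : ∀ k, Continuous (pderiv k H) := fun k =>
    (contDiff_pderiv (n := 0) (by simpa using hH) k).continuous
  have hd := hH.differentiable (by simp)
  have h := hasFDerivAt_swapMean i j hw hH x
  rw [pderiv_eq_fderiv h.differentiableAt, h.fderiv, ContinuousLinearMap.intervalIntegral_apply,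
    one_mul, one_mul, swapMean, swapMean, ← intervalIntegral.integral_add]
  · refine intervalIntegral.integral_congr fun t _ => ?_
    simp only [_root_.smul_apply, ContinuousLinearMap.comp_apply, mixSwap_single,
      map_add, map_smul, smul_eq_mul, pderiv_eq_fderiv (hd _)]
    ring
  · exact ((hw.mul continuous_id).mul ((hc _).comp hmix)).intervalIntegrable _ _
  · exact ((hw.mul (continuous_const.sub continuous_id)).mul
      ((hc _).comp hmix)).intervalIntegrable _ _
  · refine Continuous.intervalIntegrable ?_ _ _
    exact hw.smul (((hH.continuous_fderiv (by simp)).comp hmix).clm_comp (continuous_mixSwap i j))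

theorem contDiff_swapMean (i j : Fin N) {w : ℝ → ℝ} (hw : Continuous w) {n : ℕ}
    {H : (Fin N → ℝ) → ℝ} (hH : ContDiff ℝ n H) : ContDiff ℝ n (swapMean i j w H) := by
  induction n generalizing w H with
  | zero =>
    simp only [Nat.cast_zero, contDiff_zero] at hH ⊢
    exact continuous_swapMean i j hw hH
  | succ n ih =>
    have h1 : ContDiff ℝ 1 H := hH.of_le (by simp)
    refine contDiff_succ_of_pderiv
      (fun x => (hasFDerivAt_swapMean i j hw h1 x).differentiableAt) fun k => ?_
    rw [pderiv_swapMean i j hw h1]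
    exact (contDiff_const.mul (ih (by fun_prop) (contDiff_pderiv hH _))).add
      (contDiff_const.mul (ih (by fun_prop) (contDiff_pderiv hH _)))

/-- A derivative of order `n` of a mean is a sum of means of derivatives of order `n` of `H`, and
`mixSwap` fixes the diagonal, so at `diagPt N a` only the values of these derivatives at that point
enter. -/
theorem listDeriv_swapMean_eq_zero (i j : Fin N) {w : ℝ → ℝ} (hw : Continuous w) {n : ℕ}
    {H : (Fin N → ℝ) → ℝ} (hH : ContDiff ℝ n H) {a : ℝ}
    (h0 : ∀ l : List (Fin N), l.length = n → listDeriv l H (diagPt N a) = 0)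
    (l : List (Fin N)) (hl : l.length = n) :
    listDeriv l (swapMean i j w H) (diagPt N a) = 0 := by
  induction n generalizing w H l with
  | zero =>
    rw [List.length_eq_zero_iff] at hl
    subst hl
    have := h0 [] rfl
    simp only [listDeriv_nil] at this ⊢
    simp [swapMean, mixSwap_diagPt, this]
  | succ n ih =>
    -- The last entry of the list is the derivative applied first, hence the one that reaches
    -- `swapMean`.
    obtain rfl | ⟨l', k, rfl⟩ := List.eq_nil_or_concat l
    · simp at hl
    · have hl' : l'.length = n := by simpa using hl
      have hp : ∀ k, ∀ l : List (Fin N), l.length = n →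
          listDeriv l (pderiv k H) (diagPt N a) = 0 := fun k l hl => by
        have := h0 (l ++ [k]) (by simp [hl])
        rwa [listDeriv_append] at this
      rw [List.concat_eq_append, listDeriv_append, listDeriv_cons, listDeriv_nil,
        pderiv_swapMean i j hw (hH.of_le (by simp)), listDeriv_lin]
      beta_reduce
      rw [ih, ih]
      · simp
      · fun_prop
      · exact contDiff_pderiv hH _
      · exact hp _
      · exact hl'
      · fun_prop
      · exact contDiff_pderiv hH _
      · exact hp _
      · exact hl'
      · rw [hl']
        exact contDiff_swapMean i j (by fun_prop) (contDiff_pderiv hH _)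
      · rw [hl']
        exact contDiff_swapMean i j (by fun_prop) (contDiff_pderiv hH _)

/-- Hadamard's lemma: the segment from `x ∘ swap i j` to `x` has direction `(x_i - x_j)(e_i - e_j)`.
-/
theorem sub_comp_swap_eq (i j : Fin N) (hij : i ≠ j) {G : (Fin N → ℝ) → ℝ}
    (hG : ContDiff ℝ 1 G) (x : Fin N → ℝ) :
    G x - G (x ∘ Equiv.swap i j) =
      (x i - x j) * swapMean i j (fun _ => 1)
        (fun y => 1 * pderiv i G y + (-1) * pderiv j G y) x := by
  have hmix : Continuous fun t => mixSwap i j t x :=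
    (continuous_mixSwap i j).clm_apply continuous_const
  have hd := hG.differentiable (by simp)
  have hv : x - x ∘ Equiv.swap i j =
      (x i - x j) • (Pi.single i 1 - Pi.single j 1 : Fin N → ℝ) := by
    ext k
    rcases eq_or_ne k i with rfl | hk
    · simp [hij]
    · rcases eq_or_ne k j with rfl | hk'
      · simp [hk]
      · simp [hk, hk', Equiv.swap_apply_of_ne_of_ne]
  have hder : ∀ t : ℝ, HasDerivAt (fun t => G (mixSwap i j t x))
      (fderiv ℝ G (mixSwap i j t x) (x - x ∘ Equiv.swap i j)) t := by
    intro t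
    refine (hd _).hasFDerivAt.comp_hasDerivAt t ?_
    have e : (fun t => mixSwap i j t x) =
        fun t => t • (x - x ∘ Equiv.swap i j) + x ∘ Equiv.swap i j := by
      ext t k
      simp [mixSwap_apply]
      ring
    rw [e]
    simpa using ((hasDerivAt_id t).smul_const (x - x ∘ Equiv.swap i j)).add_const
      (x ∘ Equiv.swap i j)
  have := intervalIntegral.integral_eq_sub_of_hasDerivAt (a := 0) (b := 1)
    (fun t _ => hder t) (Continuous.intervalIntegrable
      (((hG.continuous_fderiv (by simp)).comp hmix).clm_apply continuous_const) _ _)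
  have e1 : mixSwap i j 1 x = x := by simp [mixSwap_apply]
  have e0 : mixSwap i j 0 x = x ∘ Equiv.swap i j := by simp [mixSwap_apply]
  rw [e1, e0] at this
  rw [← this, swapMean, ← intervalIntegral.integral_const_mul]
  refine intervalIntegral.integral_congr fun t _ => ?_
  simp only [hv, map_smul, map_sub, smul_eq_mul, pderiv_eq_fderiv (hd _)]
  ring

/-- Induction on `|J|`, starting from `D_{i} = ∂_i`. Each further index replaces the extension `G`
by minus a mean of `(∂_i - ∂_j) G`, which costs one derivative. The last clause carries the
vanishing of the derivatives of top order through the construction. -/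
theorem exists_contDiff_eq_opSet (m : ℕ) : ∀ (J : Finset (Fin N)), J.card = m + 1 →
    ∀ (n : ℕ) (φ : (Fin N → ℝ) → ℝ), IsSymm φ →
      ContDiff ℝ ((n + J.card : ℕ) : WithTop ℕ∞) φ → ∀ a : ℝ,
      ∃ G : (Fin N → ℝ) → ℝ, ContDiff ℝ n G ∧ (∀ x ∈ distinctPts N, opSet J φ x = G x) ∧
        ((∀ l : List (Fin N), l.length = n + J.card → listDeriv l φ (diagPt N a) = 0) →
          ∀ l : List (Fin N), l.length = n → listDeriv l G (diagPt N a) = 0) := by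
  induction m with
  | zero =>
    intro J hJ n φ _ hφ a
    obtain ⟨i, rfl⟩ := Finset.card_eq_one.1 hJ
    refine ⟨pderiv i φ, contDiff_pderiv hφ i, fun x _ => by simp [opSet], fun h l hl => ?_⟩
    have := h (l ++ [i]) (by simp [hl])
    rwa [listDeriv_append] at this
  | succ m ih =>
    intro J hJ n φ hs hφ a
    obtain ⟨i, J₁, hi, rfl, hJ₁⟩ := Finset.card_eq_succ.1 hJ
    obtain ⟨j, J₂, hj, rfl, hJ₂⟩ := Finset.card_eq_succ.1 hJ₁
    have hij : i ≠ j := fun h => hi (by simp [h])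
    have hi2 : i ∉ J₂ := fun h => hi (by simp [h])
    have hc : (insert i J₂).card = m + 1 := by rw [Finset.card_insert_of_notMem hi2, hJ₂]
    obtain ⟨G, hG, hGe, hG0⟩ := ih (insert i J₂) hc (n + 1) φ hs
      (by rw [hc]; rw [hJ] at hφ; convert hφ using 2; ring) a
    have hD : ContDiff ℝ n (fun y => 1 * pderiv i G y + (-1) * pderiv j G y) :=
      (contDiff_const.mul (contDiff_pderiv hG i)).add (contDiff_const.mul (contDiff_pderiv hG j))
    -- The weight `-1` accounts for the denominator `x_j - x_i` against Hadamard's factor `x_i -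
    -- x_j`.
    refine ⟨swapMean i j (fun _ => -1) (fun y => 1 * pderiv i G y + (-1) * pderiv j G y),
      contDiff_swapMean i j continuous_const hD, fun x hx => ?_, fun h l hl => ?_⟩
    -- By symmetry of `φ`, the operator of `J₂ ∪ {j}` at `x` is the operator of `J₂ ∪ {i}` at the
    -- swapped point, so one extension `G` serves both.
    · have hmap : insert j J₂ = (insert i J₂).map (Equiv.swap i j).toEmbedding := by
        ext k
        simp only [Finset.mem_insert, Finset.mem_map_equiv, Equiv.symm_swap]
        rcases eq_or_ne k i with rfl | hk
        · simp [hi2, hij.symm, hj, hij]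
        · rcases eq_or_ne k j with rfl | hk'
          · simp
          · simp [Equiv.swap_apply_of_ne_of_ne hk hk', hk, hk']
      have hx' : x ∘ Equiv.swap i j ∈ distinctPts N :=
        Function.Injective.comp hx (Equiv.injective _)
      rw [opSet_insert_insert hij hi2 hj φ hx, hmap, hs.opSet_map, hGe x hx, hGe _ hx',
        sub_comp_swap_eq i j hij (hG.of_le (by simp)),
        div_eq_iff (sub_ne_zero.2 (Function.Injective.ne hx hij.symm))]
      simp only [swapMean, neg_mul, intervalIntegral.integral_neg, one_mul]
      ring
    · refine listDeriv_swapMean_eq_zero i j continuous_const hD (fun l' hl' => ?_) l hl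
      have hk : ∀ k, listDeriv l' (pderiv k G) (diagPt N a) = 0 := fun k => by
        have := hG0 (fun l'' hl'' => h l'' (by rw [hl'', hc, hJ]; ring)) (l' ++ [k])
          (by simp [hl'])
        rwa [listDeriv_append] at this
      rw [listDeriv_lin l' (by rw [hl']; exact contDiff_pderiv hG i)
        (by rw [hl']; exact contDiff_pderiv hG j)]
      simp [hk]

theorem tendsto_opSet_zero {I : Finset (Fin N)} (hI : I.Nonempty) {φ : (Fin N → ℝ) → ℝ}
    (hs : IsSymm φ) (hφ : ContDiff ℝ I.card φ) {a : ℝ}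
    (h0 : ∀ l : List (Fin N), l.length = I.card → listDeriv l φ (diagPt N a) = 0) :
    Tendsto (opSet I φ) (𝓝[distinctPts N] diagPt N a) (𝓝 0) := by
  obtain ⟨m, hm⟩ := Nat.exists_eq_succ_of_ne_zero hI.card_pos.ne'
  obtain ⟨G, hG, hGe, hG0⟩ := exists_contDiff_eq_opSet m I hm 0 φ hs (by simpa using hφ) a
  have hz : G (diagPt N a) = 0 := hG0 (by simpa using h0) [] rfl
  have hc : Tendsto G (𝓝[distinctPts N] diagPt N a) (𝓝 0) :=
    hz ▸ (hG.continuous.tendsto _).mono_left nhdsWithin_le_nhds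
  refine hc.congr' ?_
  filter_upwards [self_mem_nhdsWithin] with x hx
  exact (hGe x hx).symm

/-! ### Multiplicities, partitions and independence of the chosen indices. -/

/-- The list in which the variable `i` occurs `h i` times. -/
def multList (h : Fin N → ℕ) : List (Fin N) :=
  (List.finRange N).flatMap fun i => List.replicate (h i) i

theorem mixedPderiv_eq_listDeriv (h : Fin N → ℕ) (φ : (Fin N → ℝ) → ℝ) :
    mixedPderiv h φ = listDeriv (multList h) φ := by
  unfold mixedPderiv multList
  induction List.finRange N with
  | nil => rfl
  | cons i l ih =>
    rw [List.foldr_cons, List.flatMap_cons, listDeriv_append, ih, listDeriv_replicate]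

theorem count_multList (h : Fin N → ℕ) (k : Fin N) : (multList h).count k = h k := by
  rw [multList, List.count_flatMap]
  have : (List.count k ∘ fun i => List.replicate (h i) i) = fun i => if i = k then h i else 0 := by
    ext i
    simp [List.count_replicate]
  rw [this, ← Fin.sum_univ_def]
  simp

theorem length_multList (h : Fin N → ℕ) : (multList h).length = ∑ i, h i := by
  rw [multList, List.length_flatMap, Fin.sum_univ_def]
  simp

theorem multList_perm (l : List (Fin N)) : (multList fun i => l.count i).Perm l :=
  List.perm_iff_count.2 fun _ => count_multList _ _

theorem map_multList_perm (h : Fin N → ℕ) (s : Equiv.Perm (Fin N)) :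
    ((multList (h ∘ s)).map s).Perm (multList h) := by
  refine List.perm_iff_count.2 fun k => ?_
  obtain ⟨i, rfl⟩ := s.surjective k
  rw [List.count_map_of_injective _ _ s.injective, count_multList, count_multList]
  rfl

theorem Realizes.map_eq {d : ℕ} {h : Fin N → ℕ} {σ : d.Partition} (hr : Realizes h σ) :
    (Finset.univ : Finset (Fin N)).val.map h =
      σ.parts + Multiset.replicate (N - σ.parts.card) 0 := by
  have h1 := Multiset.filter_add_not (· ≠ 0) ((Finset.univ : Finset (Fin N)).val.map h)
  rw [hr] at h1
  have h2 : ((Finset.univ : Finset (Fin N)).val.map h).filter (fun a => ¬ a ≠ 0) =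
      Multiset.replicate (((Finset.univ : Finset (Fin N)).val.map h).count 0) 0 := by
    rw [← Multiset.filter_eq']
    simp
  rw [h2] at h1
  have h3 := congrArg Multiset.card h1
  simp only [Multiset.card_add, Multiset.card_replicate, Multiset.card_map, Finset.card_val,
    Finset.card_univ, Fintype.card_fin] at h3
  rw [← h1]
  congr 2
  omega

theorem Realizes.sum_eq {d : ℕ} {h : Fin N → ℕ} {σ : d.Partition} (hr : Realizes h σ) :
    ∑ i, h i = d := by
  have : ((Finset.univ : Finset (Fin N)).val.map h).sum = d := by
    rw [hr.map_eq, Multiset.sum_add, σ.parts_sum]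
    simp
  exact this

/-- Two functions with the same multiset of values have equinumerous fibres; bijections between the
fibres glue to a permutation. -/
theorem Realizes.exists_perm {d : ℕ} {h h' : Fin N → ℕ} {σ : d.Partition} (hr : Realizes h σ)
    (hr' : Realizes h' σ) : ∃ s : Equiv.Perm (Fin N), h = h' ∘ s := by
  have hc : ∀ c, Nonempty ({i // h i = c} ≃ {i // h' i = c}) := fun c => by
    have h1 := congrArg (Multiset.count c) (hr.map_eq.trans hr'.map_eq.symm)
    rw [Multiset.count_map, Multiset.count_map] at h1
    refine ⟨Fintype.equivOfCardEq ?_⟩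
    rw [Fintype.card_subtype, Fintype.card_subtype, Finset.card_def, Finset.card_def]
    simpa [eq_comm] using h1
  exact ⟨Equiv.ofFiberEquiv fun c => (hc c).some,
    funext fun i => (Equiv.ofFiberEquiv_map (fun c => (hc c).some) i).symm⟩

theorem card_parts_le {d : ℕ} (σ : d.Partition) : σ.parts.card ≤ d := by
  have := Multiset.card_nsmul_le_sum (s := σ.parts) (a := 1) fun x hx => σ.parts_pos hx
  simpa [σ.parts_sum] using this

theorem realizes_stdMult {d : ℕ} (hdN : d ≤ N) (σ : d.Partition) : Realizes (stdMult N σ) σ := by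
  have hlen : (σ.parts.sort (· ≥ ·)).length ≤ N := by
    rw [Multiset.length_sort]
    exact (card_parts_le σ).trans hdN
  have h1 : List.ofFn (stdMult N σ) = σ.parts.sort (· ≥ ·) ++
      List.replicate (N - (σ.parts.sort (· ≥ ·)).length) 0 := by
    refine List.ext_getElem (by
      simp only [List.length_ofFn, List.length_append, List.length_replicate]
      omega) fun n h1 h2 => ?_
    simp only [List.getElem_ofFn, stdMult, List.getElem_append, List.getElem_replicate]
    split_ifs with h
    · rw [List.getD_eq_getElem _ _ h]
    · simp [List.getD_eq_getElem?_getD, List.getElem?_eq_none (not_lt.1 h)]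
  have h2 : (Finset.univ : Finset (Fin N)).val.map (stdMult N σ) =
      (List.ofFn (stdMult N σ) : Multiset ℕ) := by
    rw [List.ofFn_eq_map]
    rfl
  rw [Realizes, h2, h1, ← Multiset.coe_add, Multiset.filter_add, Multiset.sort_eq,
    Multiset.coe_replicate]
  have h3 : σ.parts.filter (· ≠ 0) = σ.parts :=
    Multiset.filter_eq_self.2 fun x hx => (σ.parts_pos hx).ne'
  rw [h3]
  simp [Multiset.filter_eq_nil, Multiset.mem_replicate]

theorem mixedPderiv_diagPt_eq {d : ℕ} (hdN : d ≤ N) {φ : (Fin N → ℝ) → ℝ} (hs : IsSymm φ)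
    (hφ : ContDiff ℝ d φ) {σ : d.Partition} {h : Fin N → ℕ} (hr : Realizes h σ) (a : ℝ) :
    mixedPderiv h φ (diagPt N a) = partitionDeriv σ φ (diagPt N a) := by
  obtain ⟨s, rfl⟩ := hr.exists_perm (realizes_stdMult hdN σ)
  have hl := hr.sum_eq
  rw [partitionDeriv, mixedPderiv_eq_listDeriv, mixedPderiv_eq_listDeriv,
    ← listDeriv_perm (map_multList_perm (stdMult N σ) s), listDeriv_map_perm _ _ hs]
  · rfl
  · rwa [List.length_map, length_multList, hl]

/-- The partition depends on the list only. Thus, for symmetric functions, the vanishing of all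
`∂^σ` at the diagonal point yields the hypothesis of `tendsto_opSet_zero`. -/
theorem exists_listDeriv_eq_partitionDeriv {d : ℕ} (hdN : d ≤ N) (l : List (Fin N))
    (hl : l.length = d) : ∃ σ : d.Partition, ∀ φ : (Fin N → ℝ) → ℝ, IsSymm φ → ContDiff ℝ d φ →
      ∀ a, listDeriv l φ (diagPt N a) = partitionDeriv σ φ (diagPt N a) := by
  have hsum : ((Finset.univ : Finset (Fin N)).val.map fun i => l.count i).sum = d := by
    rw [← hl, ← (multList_perm l).length_eq, length_multList]
    rfl
  have hr : Realizes (fun i => l.count i) (Nat.Partition.ofSums d _ hsum) := by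
    simp [Realizes, Nat.Partition.ofSums]
  refine ⟨Nat.Partition.ofSums d _ hsum, fun φ hs hφ a => ?_⟩
  rw [← mixedPderiv_diagPt_eq hdN hs hφ hr a, mixedPderiv_eq_listDeriv,
    listDeriv_perm (multList_perm l)]
  rwa [(multList_perm l).length_eq, hl]

/-! ### The logarithm of a generating function. -/

open Polynomial in
-- Multinomial theorem: the exponent vectors `f` with `∑ i f_i = k` are the multiplicity vectors of
-- the partitions of `k`, and `∑ f_i = l` fixes the number of parts.
theorem coeff_sum_pow (γ : ℕ → ℝ) {n k : ℕ} (hk : k ≤ n) (l : ℕ) :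
    ((∑ h ∈ Finset.Icc 1 n, C (γ h) * X ^ h : ℝ[X]) ^ l).coeff k =
      ∑ σ : k.Partition with σ.parts.card = l,
        (l.factorial : ℝ) / (∏ h ∈ Finset.Icc 1 k, ((σ.parts.count h).factorial : ℝ)) *
          (σ.parts.map γ).prod := by
  have hterm : ∀ f : ℕ → ℕ, (((Nat.multinomial (Finset.Icc 1 n) f : ℝ[X]) *
      ∏ i ∈ Finset.Icc 1 n, (C (γ i) * X ^ i) ^ f i).coeff k) =
      if ∑ i ∈ Finset.Icc 1 n, i * f i = k then
        (Nat.multinomial (Finset.Icc 1 n) f : ℝ) * ∏ i ∈ Finset.Icc 1 n, γ i ^ f i else 0 := by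
    intro f
    have : ∏ i ∈ Finset.Icc 1 n, (C (γ i) * X ^ i) ^ f i =
        C (∏ i ∈ Finset.Icc 1 n, γ i ^ f i) * X ^ (∑ i ∈ Finset.Icc 1 n, i * f i) := by
      simp only [mul_pow, Finset.prod_mul_distrib, map_prod, map_pow, ← pow_mul,
        Finset.prod_pow_eq_pow_sum]
    rw [this, ← map_natCast (C : ℝ →+* ℝ[X]), ← mul_assoc, ← map_mul, coeff_C_mul_X_pow]
    simp only [eq_comm]
  rw [Finset.sum_pow_eq_sum_piAntidiag, finsetSum_coeff, Finset.sum_congr rfl fun f _ => hterm f,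
    ← Finset.sum_filter]
  symm
  have hmem : ∀ σ : k.Partition, ∀ h ∈ σ.parts, h ∈ Finset.Icc 1 k := fun σ h hh =>
    Finset.mem_Icc.2 ⟨σ.parts_pos hh, Nat.Partition.le_of_mem_parts hh⟩
  have hsub : Finset.Icc 1 k ⊆ Finset.Icc 1 n := Finset.Icc_subset_Icc_right hk
  have hmem' : ∀ σ : k.Partition, σ.parts.toFinset ⊆ Finset.Icc 1 n := fun σ h hh =>
    hsub (hmem σ h (Multiset.mem_toFinset.1 hh))
  have hcard : ∀ σ : k.Partition, ∑ h ∈ Finset.Icc 1 n, σ.parts.count h = σ.parts.card := fun σ =>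
    Multiset.sum_count_eq_card fun h hh => hmem' σ (Multiset.mem_toFinset.2 hh)
  refine Finset.sum_bij (fun σ _ h => σ.parts.count h) ?_ ?_ ?_ ?_
  · intro σ hσ
    simp only [Finset.mem_filter, Finset.mem_univ, true_and, Finset.mem_piAntidiag] at hσ ⊢
    refine ⟨⟨(hcard σ).trans hσ, fun h hh => ?_⟩, ?_⟩
    · exact hmem' σ (Multiset.mem_toFinset.2 (Multiset.count_ne_zero.1 hh))
    · conv_rhs => rw [← σ.parts_sum, Finset.sum_multiset_count]
      symm
      rw [Finset.sum_congr rfl fun h _ => (by rw [smul_eq_mul, mul_comm] :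
        σ.parts.count h • h = h * σ.parts.count h)]
      refine Finset.sum_subset (hmem' σ) fun h _ hh => ?_
      rw [Multiset.mem_toFinset] at hh
      simp [hh]
  · intro σ _ τ _ h
    exact Nat.Partition.ext (Multiset.ext.2 fun m => congrFun h m)
  · intro f hf
    simp only [Finset.mem_filter, Finset.mem_piAntidiag] at hf
    obtain ⟨⟨hf1, hf2⟩, hf3⟩ := hf
    have hcount : ∀ m, (∑ i ∈ Finset.Icc 1 n, f i • ({i} : Multiset ℕ)).count m = f m := by
      intro m
      rw [Multiset.count_sum']
      simp only [Multiset.count_nsmul, Multiset.count_singleton, mul_ite, mul_one, mul_zero]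
      rw [Finset.sum_ite_eq]
      split_ifs with h
      · rfl
      · by_contra h'
        exact h (hf2 m (Ne.symm h'))
    refine ⟨⟨∑ i ∈ Finset.Icc 1 n, f i • ({i} : Multiset ℕ), fun {i} hi => ?_, ?_⟩, ?_, ?_⟩
    · have := Multiset.count_pos.2 hi
      rw [hcount] at this
      exact (Finset.mem_Icc.1 (hf2 i this.ne')).1
    · rw [Multiset.sum_sum]
      simp only [Multiset.sum_nsmul, Multiset.sum_singleton, smul_eq_mul]
      rw [← hf3]
      exact Finset.sum_congr rfl fun i _ => mul_comm _ _
    · simp [hf1]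
    · funext m
      exact hcount m
  · intro σ hσ
    simp only [Finset.mem_filter, Finset.mem_univ, true_and] at hσ
    have h1 := Nat.multinomial_spec (Finset.Icc 1 n) fun h => σ.parts.count h
    rw [hcard, hσ] at h1
    have h2 : ∏ h ∈ Finset.Icc 1 k, ((σ.parts.count h).factorial : ℝ) =
        ∏ h ∈ Finset.Icc 1 n, ((σ.parts.count h).factorial : ℝ) := by
      refine Finset.prod_subset hsub fun h _ hh => ?_
      rw [Multiset.count_eq_zero.2 fun hm => hh (hmem σ h hm)]
      simp
    have h3 : (σ.parts.map γ).prod = ∏ h ∈ Finset.Icc 1 n, γ h ^ σ.parts.count h := by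
      rw [Finset.prod_multiset_map_count]
      refine Finset.prod_subset (hmem' σ) fun h _ hh => ?_
      rw [Multiset.mem_toFinset] at hh
      simp [hh]
    have h4 : ∏ h ∈ Finset.Icc 1 n, ((σ.parts.count h).factorial : ℝ) ≠ 0 :=
      Finset.prod_ne_zero_iff.2 fun h _ => Nat.cast_ne_zero.2 (Nat.factorial_ne_zero _)
    rw [h2, h3, ← h1]
    push_cast
    field_simp

/-- The coefficient of degree `k` of the logarithm of the power series `1 + ∑ γ h X ^ h`. -/
def logCoeff (γ : ℕ → ℝ) (k : ℕ) : ℝ :=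
  ∑ σ : k.Partition, (-1) ^ (σ.parts.card - 1) * ((σ.parts.card - 1).factorial : ℝ) /
    (∏ h ∈ Finset.Icc 1 k, ((σ.parts.count h).factorial : ℝ)) * (σ.parts.map γ).prod

theorem card_parts_pos {d : ℕ} (hd : 1 ≤ d) (σ : d.Partition) : 1 ≤ σ.parts.card := by
  rw [Nat.one_le_iff_ne_zero, Ne, Multiset.card_eq_zero]
  intro h
  have := σ.parts_sum
  rw [h] at this
  simp at this
  omega

open Polynomial in
-- Dividing `l!` by `l` gives the `(l - 1)!` of `logCoeff`. No partition of `k ≤ n` has more than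
-- `n` parts, so truncating the logarithm at the `n`th power loses nothing.
theorem coeff_log_sum (γ : ℕ → ℝ) {n k : ℕ} (hk1 : 1 ≤ k) (hk : k ≤ n) :
    (∑ l ∈ Finset.range n, C ((-1 : ℝ) ^ l / ((l + 1 : ℕ) : ℝ)) *
      (∑ h ∈ Finset.Icc 1 n, C (γ h) * X ^ h : ℝ[X]) ^ (l + 1)).coeff k = logCoeff γ k := by
  rw [finsetSum_coeff]
  simp only [coeff_C_mul, coeff_sum_pow γ hk, Finset.mul_sum]
  rw [logCoeff, ← Finset.sum_fiberwise_of_maps_to (s := Finset.univ) (t := Finset.range n)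
    (g := fun σ : k.Partition => σ.parts.card - 1)]
  · refine Finset.sum_congr rfl fun l _ => ?_
    have : (Finset.univ.filter fun σ : k.Partition => σ.parts.card = l + 1) =
        Finset.univ.filter fun σ : k.Partition => σ.parts.card - 1 = l := by
      ext σ
      have := card_parts_pos hk1 σ
      simp only [Finset.mem_filter, Finset.mem_univ, true_and]
      omega
    rw [this]
    refine Finset.sum_congr rfl fun σ hσ => ?_
    simp only [Finset.mem_filter, Finset.mem_univ, true_and] at hσ
    rw [hσ, Nat.factorial_succ]
    have : ((l + 1 : ℕ) : ℝ) ≠ 0 := by positivity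
    push_cast at this ⊢
    field_simp
  · intro σ _
    have := card_parts_pos hk1 σ
    have := card_parts_le σ
    rw [Finset.mem_range]
    omega

open Polynomial in
-- This is `F' = (log F)' F` in degree `n`. It serves both the test functions and the coordinates
-- `u_r`.
theorem succ_mul_eq_sum_logCoeff {γ : ℕ → ℝ} (h0 : γ 0 = 1) (n : ℕ) :
    ((n + 1 : ℕ) : ℝ) * γ (n + 1) =
      ∑ p ∈ Finset.HasAntidiagonal.antidiagonal n,
        ((p.1 + 1 : ℕ) : ℝ) * logCoeff γ (p.1 + 1) * γ p.2 := by
  set U : ℝ[X] := ∑ h ∈ Finset.Icc 1 (n + 1), C (γ h) * X ^ h with hU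
  set Λ : ℝ[X] := ∑ l ∈ Finset.range (n + 1), C ((-1 : ℝ) ^ l / ((l + 1 : ℕ) : ℝ)) * U ^ (l + 1)
    with hΛ
  have hUc : ∀ j, j ≤ n + 1 → (1 + U).coeff j = γ j := by
    intro j hj
    rw [hU, coeff_add, finsetSum_coeff, coeff_one]
    simp only [coeff_C_mul_X_pow]
    rw [Finset.sum_ite_eq]
    rcases Nat.eq_zero_or_pos j with rfl | hj'
    · simp [h0]
    · rw [if_neg hj'.ne', if_pos (Finset.mem_Icc.2 ⟨hj', hj⟩), zero_add]
  have hder : derivative Λ = (∑ l ∈ Finset.range (n + 1), (-U) ^ l) * derivative U := by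
    rw [hΛ, derivative_sum, Finset.sum_mul]
    refine Finset.sum_congr rfl fun l _ => ?_
    have hl : ((l + 1 : ℕ) : ℝ) ≠ 0 := by positivity
    have hC : C ((-1 : ℝ) ^ l / ((l + 1 : ℕ) : ℝ)) * C ((l : ℝ) + 1) = (-1) ^ l := by
      rw [← C_mul, ← Nat.cast_succ, div_mul_cancel₀ _ hl]
      simp
    rw [derivative_C_mul, derivative_pow_succ, neg_pow U, ← hC]
    ring
  -- For the truncated logarithm the identity holds up to the remainder of a geometric sum, which is
  -- divisible by `X ^ (n + 1)` because `U` has no constant term.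
  have hmul : derivative Λ * (1 + U) = derivative (1 + U) - (-U) ^ (n + 1) * derivative U := by
    have := geom_sum_mul (-U) (n + 1)
    rw [hder, derivative_add, derivative_one]
    linear_combination (-derivative U) * this
  have hX : X ∣ U := by
    rw [hU]
    refine Finset.dvd_sum fun h hh => Dvd.dvd.mul_left (dvd_pow_self X ?_) _
    have := (Finset.mem_Icc.1 hh).1
    omega
  have hz : ((-U) ^ (n + 1) * derivative U).coeff n = 0 := by
    have : X ^ (n + 1) ∣ (-U) ^ (n + 1) * derivative U :=
      Dvd.dvd.mul_right (pow_dvd_pow_of_dvd ((dvd_neg).2 hX) _) _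
    exact X_pow_dvd_iff.1 this n (Nat.lt_succ_self n)
  have hc := congrArg (fun p => coeff p n) hmul
  simp only [coeff_sub, hz, sub_zero, coeff_mul, coeff_derivative] at hc
  rw [hUc _ le_rfl] at hc
  rw [mul_comm]
  push_cast
  rw [← hc]
  refine Finset.sum_congr rfl fun p hp => ?_
  have hp' := Finset.HasAntidiagonal.mem_antidiagonal.1 hp
  rw [hUc _ (by omega), coeff_log_sum γ (by omega) (by omega)]
  ring

/-! ### The exponential test functions. -/

theorem pderiv_prod (g : Fin N → ℝ → ℝ) (k : Fin N) :
    pderiv k (fun x => ∏ i, g i (x i)) =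
      fun x => (∏ i ∈ Finset.univ.erase k, g i (x i)) * deriv (g k) (x k) := by
  ext x
  simp only [pderiv, lineDeriv]
  have h1 : (fun t : ℝ => ∏ i, g i ((x + t • (Pi.single k 1 : Fin N → ℝ)) i)) =
      fun t => (∏ i ∈ Finset.univ.erase k, g i (x i)) * g k (x k + t) := by
    ext t
    rw [← Finset.prod_erase_mul _ _ (Finset.mem_univ k)]
    congr 1
    · refine Finset.prod_congr rfl fun i hi => ?_
      simp [Finset.ne_of_mem_erase hi]
    · simp
  rw [h1, deriv_const_mul_field, deriv_comp_const_add, add_zero]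

theorem pderiv_traceFun (f : ℝ → ℝ) (k : Fin N) :
    pderiv k (traceFun N f) = fun x => deriv f (x k) := by
  ext x
  simp only [pderiv, lineDeriv, traceFun]
  have h1 : (fun t : ℝ => ∑ i, f ((x + t • (Pi.single k 1 : Fin N → ℝ)) i)) =
      fun t => (∑ i ∈ Finset.univ.erase k, f (x i)) + f (x k + t) := by
    ext t
    rw [← Finset.sum_erase_add _ _ (Finset.mem_univ k)]
    congr 1
    · refine Finset.sum_congr rfl fun i hi => ?_
      simp [Finset.ne_of_mem_erase hi]
    · simp
  rw [h1, deriv_const_add, deriv_comp_const_add, add_zero]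

theorem listDeriv_prod (g : Fin N → ℝ → ℝ) (l : List (Fin N)) :
    listDeriv l (fun x => ∏ i, g i (x i)) =
      fun x => ∏ i, iteratedDeriv (l.count i) (g i) (x i) := by
  induction l with
  | nil => simp
  | cons k l ih =>
    rw [listDeriv_cons, ih, pderiv_prod fun i => iteratedDeriv (l.count i) (g i)]
    ext x
    rw [← Finset.prod_erase_mul _ _ (Finset.mem_univ k), ← iteratedDeriv_succ]
    congr 1
    · refine Finset.prod_congr rfl fun i hi => ?_
      rw [List.count_cons_of_ne (Finset.ne_of_mem_erase hi).symm]
    · rw [List.count_cons_self]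

theorem partitionDeriv_prod {d : ℕ} (hdN : d ≤ N) (σ : d.Partition) (g : ℝ → ℝ) {a : ℝ}
    (h1 : g a = 1) : partitionDeriv σ (fun x => ∏ i : Fin N, g (x i)) (diagPt N a) =
      (σ.parts.map fun h => iteratedDeriv h g a).prod := by
  rw [partitionDeriv, mixedPderiv_eq_listDeriv, listDeriv_prod fun _ => g]
  simp only [count_multList, diagPt]
  have h2 : ∏ i, iteratedDeriv (stdMult N σ i) g a =
      (((Finset.univ : Finset (Fin N)).val.map (stdMult N σ)).map
        fun h => iteratedDeriv h g a).prod := by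
    rw [Multiset.map_map]
    rfl
  rw [h2, (realizes_stdMult hdN σ).map_eq]
  simp [h1]

open Polynomial in
theorem iteratedDeriv_polynomial_eval (P : ℝ[X]) (n : ℕ) :
    iteratedDeriv n (fun x => P.eval x) = fun x => (derivative^[n] P).eval x := by
  induction n with
  | zero => simp
  | succ n ih =>
    rw [iteratedDeriv_succ, ih, Function.iterate_succ_apply']
    ext x
    exact Polynomial.deriv _

open Polynomial in
/-- The polynomial in `X - a` of degree at most `d` with the coefficients `logCoeff γ`. -/
def logPoly (γ : ℕ → ℝ) (d : ℕ) (a : ℝ) : ℝ[X] :=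
  ∑ k ∈ Finset.Icc 1 d, C (logCoeff γ k) * (X - C a) ^ k

open Polynomial in
theorem eval_logPoly (γ : ℕ → ℝ) (d : ℕ) (a : ℝ) : (logPoly γ d a).eval a = 0 := by
  rw [logPoly, eval_finsetSum]
  refine Finset.sum_eq_zero fun k hk => ?_
  have := (Finset.mem_Icc.1 hk).1
  simp [show k ≠ 0 by omega]

open Polynomial in
theorem eval_iterate_derivative_logPoly (γ : ℕ → ℝ) {d j : ℕ} (a : ℝ) (h1 : 1 ≤ j) (hj : j ≤ d) :
    (derivative^[j] (logPoly γ d a)).eval a = (j.factorial : ℝ) * logCoeff γ j := by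
  rw [logPoly, iterate_derivative_sum, eval_finsetSum,
    Finset.sum_eq_single_of_mem j (Finset.mem_Icc.2 ⟨h1, hj⟩)]
  · rw [iterate_derivative_C_mul, iterate_derivative_X_sub_pow_self]
    simp [mul_comm]
  · intro k _ hk
    rw [iterate_derivative_C_mul, iterate_derivative_X_sub_pow]
    rcases lt_or_gt_of_ne hk with h | h
    · simp [Nat.descFactorial_eq_zero_iff_lt.2 h]
    · simp [show k - j ≠ 0 by omega]

open Polynomial in
theorem natDegree_logPoly_le (γ : ℕ → ℝ) (d : ℕ) (a : ℝ) : (logPoly γ d a).natDegree ≤ d := by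
  refine natDegree_sum_le_of_forall_le _ _ fun k hk => ?_
  refine (natDegree_C_mul_le _ _).trans ?_
  rw [natDegree_pow, natDegree_X_sub_C, mul_one]
  exact (Finset.mem_Icc.1 hk).2

open Polynomial in
theorem coeff_logPoly (γ : ℕ → ℝ) {d : ℕ} (hd : 1 ≤ d) (a : ℝ) :
    (logPoly γ d a).coeff d = logCoeff γ d := by
  rw [logPoly, finsetSum_coeff, Finset.sum_eq_single_of_mem d (Finset.mem_Icc.2 ⟨hd, le_rfl⟩)]
  · have := (monic_X_sub_C a).pow d
    rw [Monic, leadingCoeff, natDegree_pow, natDegree_X_sub_C, mul_one] at this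
    rw [coeff_C_mul, this, mul_one]
  · intro k hk hkd
    rw [coeff_C_mul, coeff_eq_zero_of_natDegree_lt, mul_zero]
    rw [natDegree_pow, natDegree_X_sub_C, mul_one]
    exact lt_of_le_of_ne (Finset.mem_Icc.1 hk).2 hkd

theorem deriv_exp_polynomial (P : Polynomial ℝ) :
    deriv (fun x => Real.exp (P.eval x)) =
      (fun x => Real.exp (P.eval x)) * fun x => P.derivative.eval x := by
  ext x
  exact ((P.hasDerivAt x).exp).deriv

theorem contDiff_polynomial_eval (P : Polynomial ℝ) (n : WithTop ℕ∞) :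
    ContDiff ℝ n fun x => P.eval x := by
  simpa using P.contDiff_aeval (𝕜 := ℝ) n

/-- `logPoly` is the truncated logarithm of `∑ γ_h (X - a)^h`, so its exponential has Taylor
coefficients `γ_n` up to order `d`. Leibniz' rule for `(exp P)' = P' exp P` yields the recursion of
`succ_mul_eq_sum_logCoeff`. -/
theorem iteratedDeriv_exp_logPoly {γ : ℕ → ℝ} (h0 : γ 0 = 1) (d : ℕ) (a : ℝ) :
    ∀ n ≤ d, iteratedDeriv n (fun x => Real.exp ((logPoly γ d a).eval x)) a =
      (n.factorial : ℝ) * γ n := by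
  intro n
  induction n using Nat.strong_induction_on with
  | _ n ih =>
    intro hn
    obtain _ | n := n
    · simp [eval_logPoly, h0]
    · rw [iteratedDeriv_succ', deriv_exp_polynomial, mul_comm,
        iteratedDeriv_mul (contDiff_polynomial_eval _ _).contDiffAt
          (contDiff_polynomial_eval _ _).exp.contDiffAt, Nat.factorial_succ, mul_comm (n + 1),
        Nat.cast_mul, mul_assoc, succ_mul_eq_sum_logCoeff h0,
        Finset.Nat.sum_antidiagonal_eq_sum_range_succ_mk, Finset.mul_sum]
      refine Finset.sum_congr rfl fun i hi => ?_
      have hi' : i ≤ n := Nat.lt_succ_iff.1 (Finset.mem_range.1 hi)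
      rw [ih (n - i) (by omega) (by omega), iteratedDeriv_polynomial_eval,
        ← Function.iterate_succ_apply, Nat.succ_eq_add_one]
      beta_reduce
      rw [eval_iterate_derivative_logPoly γ a (by omega) (by omega),
        ← Nat.choose_mul_factorial_mul_factorial hi', Nat.factorial_succ]
      push_cast
      ring

/-- The symmetric function `x ↦ ∏ᵢ exp (P (xᵢ))`, with `P` the polynomial `logPoly γ d a`. -/
def expTrace (N : ℕ) (γ : ℕ → ℝ) (d : ℕ) (a : ℝ) (x : Fin N → ℝ) : ℝ :=
  ∏ i, Real.exp ((logPoly γ d a).eval (x i))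

theorem isSymm_expTrace (γ : ℕ → ℝ) (d : ℕ) (a : ℝ) : IsSymm (expTrace N γ d a) := fun s x =>
  Equiv.prod_comp s fun i => Real.exp ((logPoly γ d a).eval (x i))

theorem contDiff_expTrace (γ : ℕ → ℝ) (d : ℕ) (a : ℝ) (n : WithTop ℕ∞) :
    ContDiff ℝ n (expTrace N γ d a) :=
  contDiff_prod fun i _ =>
    ((contDiff_polynomial_eval _ _).comp (contDiff_apply ℝ ℝ i)).exp

theorem expTrace_diagPt (γ : ℕ → ℝ) (d : ℕ) (a : ℝ) : expTrace N γ d a (diagPt N a) = 1 := by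
  simp [expTrace, diagPt, eval_logPoly]

theorem map_parts_prod {d : ℕ} (σ : d.Partition) (f : ℕ → ℝ) :
    (σ.parts.map f).prod = ∏ h ∈ Finset.Icc 1 d, f h ^ σ.parts.count h := by
  rw [Finset.prod_multiset_map_count]
  refine Finset.prod_subset (fun h hh => ?_) fun h _ hh => ?_
  · rw [Multiset.mem_toFinset] at hh
    exact Finset.mem_Icc.2 ⟨σ.parts_pos hh, Nat.Partition.le_of_mem_parts hh⟩
  · rw [Multiset.mem_toFinset] at hh
    simp [hh]

theorem partitionDeriv_expTrace {γ : ℕ → ℝ} (h0 : γ 0 = 1) {d : ℕ} (hdN : d ≤ N) (a : ℝ)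
    (σ : d.Partition) : partitionDeriv σ (expTrace N γ d a) (diagPt N a) =
      (σ.parts.map fun h => (h.factorial : ℝ) * γ h).prod := by
  have := partitionDeriv_prod hdN σ (fun x => Real.exp ((logPoly γ d a).eval x)) (a := a)
    (by simp [eval_logPoly])
  refine this.trans ?_
  congr 1
  exact Multiset.map_congr rfl fun h hh =>
    iteratedDeriv_exp_logPoly h0 d a h (Nat.Partition.le_of_mem_parts hh)

/-- The factors `h!` cancel those in `partitionCoeff`, leaving the logarithm coefficient with
`(-1)^(d - l) = (-1)^(d - 1) (-1)^(l - 1)`. -/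
theorem sum_partitionCoeff_mul (γ : ℕ → ℝ) {d : ℕ} (hd : 1 ≤ d) :
    ∑ σ : d.Partition, partitionCoeff σ * (σ.parts.map fun h => (h.factorial : ℝ) * γ h).prod =
      (-1) ^ (d - 1) * ((d : ℝ) * logCoeff γ d) := by
  rw [logCoeff, Finset.mul_sum, Finset.mul_sum]
  refine Finset.sum_congr rfl fun σ _ => ?_
  have h1 := card_parts_pos hd σ
  have h2 := card_parts_le σ
  rw [Multiset.prod_map_mul, map_parts_prod σ fun h => (h.factorial : ℝ), partitionCoeff,
    Finset.prod_mul_distrib]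
  have h3 : ∏ h ∈ Finset.Icc 1 d, (h.factorial : ℝ) ^ σ.parts.count h ≠ 0 :=
    Finset.prod_ne_zero_iff.2 fun h _ => pow_ne_zero _ (Nat.cast_ne_zero.2 h.factorial_ne_zero)
  have h4 : ∏ h ∈ Finset.Icc 1 d, ((σ.parts.count h).factorial : ℝ) ≠ 0 :=
    Finset.prod_ne_zero_iff.2 fun h _ => Nat.cast_ne_zero.2 (Nat.factorial_ne_zero _)
  have h5 : (-1 : ℝ) ^ (d - 1) * (-1) ^ (σ.parts.card - 1) = (-1) ^ (d - σ.parts.card) := by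
    rw [← pow_add, show d - 1 + (σ.parts.card - 1) =
      d - σ.parts.card + 2 * (σ.parts.card - 1) by omega, pow_add, pow_mul]
    simp
  rw [← h5]
  field_simp

/-- Since `∂_k φ = φ P'(x_k)`, this is `φ` times a divided difference of `P'`. As `deg P' < d =
|I|`, Lagrange interpolation reads off its coefficient of degree `d - 1`. -/
theorem opSet_expTrace (γ : ℕ → ℝ) {d : ℕ} (hd : 1 ≤ d) (a : ℝ) {I : Finset (Fin N)}
    (hI : I.card = d) {x : Fin N → ℝ} (hx : Function.Injective x) :
    opSet I (expTrace N γ d a) x =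
      expTrace N γ d a x * ((-1) ^ (d - 1) * ((d : ℝ) * logCoeff γ d)) := by
  set P := logPoly γ d a with hP
  have hp : ∀ k, pderiv k (expTrace N γ d a) x =
      expTrace N γ d a x * P.derivative.eval (x k) := fun k => by
    have := congrFun (pderiv_prod (fun _ : Fin N => fun y => Real.exp (P.eval y)) k) x
    refine this.trans ?_
    rw [deriv_exp_polynomial, Pi.mul_apply, ← mul_assoc,
      Finset.prod_erase_mul _ (fun i => Real.exp (P.eval (x i))) (Finset.mem_univ k)]
    rfl
  have hdeg : P.derivative.degree < (I.card : ℕ) := by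
    refine lt_of_le_of_lt Polynomial.degree_le_natDegree (Nat.cast_lt.2 ?_)
    have h1 := Polynomial.natDegree_derivative_le P
    have h2 : P.natDegree ≤ d := natDegree_logPoly_le γ d a
    omega
  have hcoeff := Lagrange.coeff_eq_sum (s := I) (v := x) hx.injOn hdeg
  rw [hI, Polynomial.coeff_derivative, Nat.sub_add_cancel hd, hP, coeff_logPoly γ hd] at hcoeff
  have hcast : ((d - 1 : ℕ) : ℝ) + 1 = d := by
    rw [← Nat.cast_succ]
    congr 1
    omega
  rw [hcast] at hcoeff
  rw [mul_comm (d : ℝ), hcoeff, Finset.mul_sum, Finset.mul_sum, opSet]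
  refine Finset.sum_congr rfl fun i hi => ?_
  -- Lagrange's formula has the denominators `x_i - x_j`, the operator has `x_j - x_i`; there are `d
  -- - 1` factors.
  have hsign : ∏ j ∈ I.erase i, (x j - x i) = (-1) ^ (d - 1) * ∏ j ∈ I.erase i, (x i - x j) := by
    rw [← hI, ← Finset.card_erase_of_mem hi, ← Finset.prod_const, ← Finset.prod_mul_distrib]
    exact Finset.prod_congr rfl fun j _ => by ring
  have hne : ∏ j ∈ I.erase i, (x i - x j) ≠ 0 :=
    Finset.prod_ne_zero_iff.2 fun j hj =>
      sub_ne_zero.2 (hx.ne (Finset.ne_of_mem_erase hj).symm)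
  rw [hp, hsign]
  have hm : (-1 : ℝ) ^ (d - 1) * (-1) ^ (d - 1) = 1 := by
    rw [← mul_pow]
    simp
  have hm' : (-1 : ℝ) ^ (d - 1) ≠ 0 := pow_ne_zero _ (by norm_num)
  field_simp
  rw [sq, hm, mul_one]

theorem tendsto_opSet_expTrace (γ : ℕ → ℝ) {d : ℕ} (hd : 1 ≤ d) (a : ℝ) {I : Finset (Fin N)}
    (hI : I.card = d) :
    Tendsto (opSet I (expTrace N γ d a)) (𝓝[distinctPts N] diagPt N a)
      (𝓝 ((-1) ^ (d - 1) * ((d : ℝ) * logCoeff γ d))) := by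
  have h1 := (((contDiff_expTrace (N := N) γ d a 0).continuous.tendsto (diagPt N a)).mono_left
    (nhdsWithin_le_nhds (s := distinctPts N))).mul_const
      ((-1) ^ (d - 1) * ((d : ℝ) * logCoeff γ d))
  rw [expTrace_diagPt, one_mul] at h1
  refine h1.congr' ?_
  filter_upwards [self_mem_nhdsWithin] with x hx
  exact (opSet_expTrace γ hd a hI hx).symm

theorem opSet_lin (I : Finset (Fin N)) {φ ψ : (Fin N → ℝ) → ℝ} (hφ : Differentiable ℝ φ)
    (hψ : Differentiable ℝ ψ) (b c : ℝ) :
    opSet I (fun y => b * φ y + c * ψ y) = fun x => b * opSet I φ x + c * opSet I ψ x := by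
  ext x
  simp only [opSet, Finset.mul_sum, ← Finset.sum_add_distrib]
  refine Finset.sum_congr rfl fun i _ => ?_
  rw [pderiv_lin (hφ x) (hψ x)]
  ring

theorem length_multList_stdMult {d : ℕ} (hdN : d ≤ N) (σ : d.Partition) :
    (multList (stdMult N σ)).length = d := by
  rw [length_multList, (realizes_stdMult hdN σ).sum_eq]

theorem partitionDeriv_lin {d : ℕ} (hdN : d ≤ N) (σ : d.Partition) {φ ψ : (Fin N → ℝ) → ℝ}
    (hφ : ContDiff ℝ d φ) (hψ : ContDiff ℝ d ψ) (b c : ℝ) (x : Fin N → ℝ) :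
    partitionDeriv σ (fun y => b * φ y + c * ψ y) x =
      b * partitionDeriv σ φ x + c * partitionDeriv σ ψ x := by
  simp only [partitionDeriv, mixedPderiv_eq_listDeriv]
  rw [listDeriv_lin]
  · rwa [length_multList_stdMult hdN]
  · rwa [length_multList_stdMult hdN]

/-! ### The limit of `D_I φ` for every symmetric `φ`. -/

/-- The vector `w` is the vector of the derivatives of order `d` on the diagonal of a symmetric
function for which the operators `D_I`, `|I| = d`, have the expected limit there. -/
def IsGoodJet (N d : ℕ) (a : ℝ) (w : d.Partition → ℝ) : Prop :=
  ∃ φ : (Fin N → ℝ) → ℝ, IsSymm φ ∧ ContDiff ℝ d φ ∧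
    (∀ σ, partitionDeriv σ φ (diagPt N a) = w σ) ∧
    ∀ I : Finset (Fin N), I.card = d →
      Tendsto (opSet I φ) (𝓝[distinctPts N] diagPt N a) (𝓝 (∑ σ, partitionCoeff σ * w σ))

theorem IsGoodJet.lin {d : ℕ} (hd : 1 ≤ d) (hdN : d ≤ N) {a : ℝ} {w w' : d.Partition → ℝ}
    (h : IsGoodJet N d a w) (h' : IsGoodJet N d a w') (b c : ℝ) :
    IsGoodJet N d a (b • w + c • w') := by
  obtain ⟨φ, hs, hφ, hw, ht⟩ := h
  obtain ⟨φ', hs', hφ', hw', ht'⟩ := h'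
  have hd' : ((d : ℕ) : WithTop ℕ∞) ≠ 0 := by
    exact_mod_cast (by omega : d ≠ 0)
  refine ⟨fun y => b * φ y + c * φ' y, fun s x => ?_, by fun_prop, fun σ => ?_, fun I hI => ?_⟩
  · simp only [hs s x, hs' s x]
  · rw [partitionDeriv_lin hdN σ hφ hφ', hw, hw']
    rfl
  · rw [opSet_lin I (hφ.differentiable hd') (hφ'.differentiable hd')]
    convert ((ht I hI).const_mul b).add ((ht' I hI).const_mul c) using 2
    rw [Finset.mul_sum, Finset.mul_sum, ← Finset.sum_add_distrib]
    refine Finset.sum_congr rfl fun σ _ => ?_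
    simp only [Pi.add_apply, Pi.smul_apply, smul_eq_mul]
    ring

theorem isGoodJet_prod {d : ℕ} (hd : 1 ≤ d) (hdN : d ≤ N) (a : ℝ) (ρ : ℕ → ℝ) :
    IsGoodJet N d a fun σ => (σ.parts.map ρ).prod := by
  -- The value at `0` is forced to be `1`; this is harmless because the parts of a partition are
  -- positive.
  set γ : ℕ → ℝ := fun h => if h = 0 then 1 else ρ h / h.factorial with hγ
  have h0 : γ 0 = 1 := by simp [hγ]
  have hmap : ∀ σ : d.Partition,
      (σ.parts.map fun h => (h.factorial : ℝ) * γ h).prod = (σ.parts.map ρ).prod := fun σ => by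
    congr 1
    refine Multiset.map_congr rfl fun h hh => ?_
    rw [hγ]
    simp only [if_neg (σ.parts_pos hh).ne']
    exact mul_div_cancel₀ _ (Nat.cast_ne_zero.2 h.factorial_ne_zero)
  refine ⟨expTrace N γ d a, isSymm_expTrace γ d a, contDiff_expTrace γ d a _, fun σ => ?_,
    fun I hI => ?_⟩
  · rw [partitionDeriv_expTrace h0 hdN, hmap]
  · simp only [← hmap]
    rw [sum_partitionCoeff_mul γ hd]
    exact tendsto_opSet_expTrace γ hd a hI

/-- Distinct partitions give distinct monomials, and a polynomial vanishing everywhere on the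
infinite field `ℝ` is zero. -/
theorem eq_zero_of_forall_sum_prod_eq_zero {d : ℕ} {c : d.Partition → ℝ}
    (h : ∀ ρ : ℕ → ℝ, ∑ σ, c σ * (σ.parts.map ρ).prod = 0) : c = 0 := by
  set p : MvPolynomial ℕ ℝ := ∑ σ, MvPolynomial.monomial (Multiset.toFinsupp σ.parts) (c σ)
    with hp
  have hp0 : p = 0 := by
    refine MvPolynomial.funext fun ρ => ?_
    rw [hp, map_sum, map_zero, ← h ρ]
    refine Finset.sum_congr rfl fun σ _ => ?_
    rw [MvPolynomial.eval_monomial, Finset.prod_multiset_map_count]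
    rfl
  ext σ
  have h1 := congrArg (MvPolynomial.coeff (Multiset.toFinsupp σ.parts)) hp0
  rw [hp, MvPolynomial.coeff_sum, Finset.sum_eq_single σ] at h1
  · simpa using h1
  · intro τ _ hτ
    rw [MvPolynomial.coeff_monomial, if_neg]
    exact fun he => hτ (Nat.Partition.ext (Multiset.toFinsupp.injective he))
  · simp

/-- Good vectors form a subspace. Were it proper, a nonzero functional would vanish on it, in
particular on all the monomial vectors, against their independence. -/
theorem isGoodJet_all {d : ℕ} (hd : 1 ≤ d) (hdN : d ≤ N) (a : ℝ) (w : d.Partition → ℝ) :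
    IsGoodJet N d a w := by
  let Q : Submodule ℝ (d.Partition → ℝ) :=
    { carrier := {w | IsGoodJet N d a w}
      zero_mem' := by
        simpa using (isGoodJet_prod hd hdN a fun _ => 0).lin hd hdN
          (isGoodJet_prod hd hdN a fun _ => 0) 0 0
      add_mem' := fun {w w'} h h' => by simpa using IsGoodJet.lin hd hdN h h' 1 1
      smul_mem' := fun b w h => by simpa using IsGoodJet.lin hd hdN h h b 0 }
  suffices hQ : Q = ⊤ by
    have : w ∈ Q := hQ ▸ Submodule.mem_top
    exact this
  by_contra hne
  obtain ⟨f, hf, hQf⟩ := Q.exists_le_ker_of_lt_top (lt_top_iff_ne_top.2 hne)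
  have hf' : ∀ w, f w = ∑ σ, f (Pi.single σ 1) * w σ := fun w => by
    conv_lhs => rw [← Finset.univ_sum_single w]
    rw [map_sum]
    refine Finset.sum_congr rfl fun σ _ => ?_
    rw [mul_comm, ← smul_eq_mul, ← map_smul, ← Pi.single_smul, smul_eq_mul, mul_one]
  have hc := eq_zero_of_forall_sum_prod_eq_zero (c := fun σ : d.Partition => f (Pi.single σ 1))
    fun ρ => by
      rw [← hf' fun σ => (σ.parts.map ρ).prod]
      exact hQf (isGoodJet_prod hd hdN a ρ)
  refine hf (LinearMap.ext fun w => ?_)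
  rw [hf', LinearMap.zero_apply]
  exact Finset.sum_eq_zero fun σ _ => by rw [congrFun hc σ, Pi.zero_apply, zero_mul]

/-- Subtract a good function with the same derivatives of order `d` at the diagonal point;
`tendsto_opSet_zero` applies to the difference. -/
theorem tendsto_opSet_diagDeriv {d : ℕ} (hd : 1 ≤ d) (hdN : d ≤ N) {φ : (Fin N → ℝ) → ℝ}
    (hs : IsSymm φ) (hφ : ContDiff ℝ d φ) (a : ℝ) {I : Finset (Fin N)} (hI : I.card = d) :
    Tendsto (opSet I φ) (𝓝[distinctPts N] diagPt N a) (𝓝 (diagDeriv d φ (diagPt N a))) := by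
  obtain ⟨ψ, hsψ, hψ, hw, ht⟩ :=
    isGoodJet_all hd hdN a fun σ => partitionDeriv σ φ (diagPt N a)
  have hd' : ((d : ℕ) : WithTop ℕ∞) ≠ 0 := by
    exact_mod_cast (by omega : d ≠ 0)
  have hne : I.Nonempty := Finset.card_pos.1 (by omega)
  have h0 : Tendsto (opSet I fun y => 1 * φ y + (-1) * ψ y) (𝓝[distinctPts N] diagPt N a)
      (𝓝 0) := by
    refine tendsto_opSet_zero hne (fun s x => ?_) (by rw [hI]; fun_prop) fun l hl => ?_
    · simp only [hs s x, hsψ s x]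
    · rw [hI] at hl
      obtain ⟨σ, hσ⟩ := exists_listDeriv_eq_partitionDeriv hdN l hl
      rw [hσ _ (fun s x => by simp only [hs s x, hsψ s x]) (by fun_prop),
        partitionDeriv_lin hdN σ hφ hψ, hw]
      ring
  rw [opSet_lin I (hφ.differentiable hd') (hψ.differentiable hd')] at h0
  have := h0.add (ht I hI)
  rw [zero_add] at this
  refine this.congr fun x => ?_
  ring

/-! ### The action of `D_I` on elementary symmetric functions. -/

/-- The elementary symmetric polynomial of degree `k - m` in the variables in `S`, or `0` if
`k < m`. -/
def esShift (S : Finset (Fin N)) (m k : ℕ) (x : Fin N → ℝ) : ℝ :=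
  if m ≤ k then ∑ T ∈ S.powersetCard (k - m), ∏ i ∈ T, x i else 0

theorem esShift_insert {i : Fin N} {S : Finset (Fin N)} (hi : i ∉ S) (m k : ℕ) (x : Fin N → ℝ) :
    esShift (insert i S) m k x = esShift S m k x + x i * esShift S (m + 1) k x := by
  unfold esShift
  rcases lt_trichotomy m k with h | rfl | h
  · obtain ⟨r, rfl⟩ := Nat.exists_eq_add_of_lt h
    rw [if_pos h.le, if_pos h.le, if_pos (by omega), show m + r + 1 - m = r + 1 by omega,
      show m + r + 1 - (m + 1) = r by omega, Finset.powersetCard_succ_insert hi,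
      Finset.sum_union, Finset.sum_image, Finset.mul_sum]
    · congr 1
      refine Finset.sum_congr rfl fun T hT => ?_
      rw [Finset.prod_insert fun h => hi ((Finset.mem_powersetCard.1 hT).1 h)]
    · intro T hT T' hT' he
      have h1 : i ∉ T := fun h => hi ((Finset.mem_powersetCard.1 hT).1 h)
      have h2 : i ∉ T' := fun h => hi ((Finset.mem_powersetCard.1 hT').1 h)
      rw [← Finset.erase_insert h1, ← Finset.erase_insert h2]
      exact congrArg (fun s => Finset.erase s i) he
    · refine Finset.disjoint_left.2 fun T hT hT' => ?_
      obtain ⟨T', _, rfl⟩ := Finset.mem_image.1 hT'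
      exact hi ((Finset.mem_powersetCard.1 hT).1 (Finset.mem_insert_self _ _))
  · simp
  · rw [if_neg (by omega), if_neg (by omega), if_neg (by omega)]
    simp

theorem esShift_congr {S : Finset (Fin N)} {x y : Fin N → ℝ} (h : ∀ i ∈ S, x i = y i) (m k : ℕ) :
    esShift S m k x = esShift S m k y := by
  unfold esShift
  congr 1
  refine Finset.sum_congr rfl fun T hT => Finset.prod_congr rfl fun i hi => h i ?_
  exact (Finset.mem_powersetCard.1 hT).1 hi

theorem esShift_diagPt (S : Finset (Fin N)) (m k : ℕ) (a : ℝ) :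
    esShift S m k (diagPt N a) = if m ≤ k then (S.card.choose (k - m) : ℝ) * a ^ (k - m) else 0 := by
  unfold esShift diagPt
  congr 1
  rw [Finset.sum_congr rfl fun T hT => by
    rw [Finset.prod_const, (Finset.mem_powersetCard.1 hT).2]]
  simp

theorem contDiff_esShift (S : Finset (Fin N)) (m k : ℕ) (n : WithTop ℕ∞) :
    ContDiff ℝ n (esShift S m k) := by
  unfold esShift
  split_ifs
  · exact ContDiff.sum fun T _ => contDiff_prod fun i _ => contDiff_apply ℝ ℝ i
  · exact contDiff_const

theorem pderiv_esShift_univ (i : Fin N) (k : ℕ) (x : Fin N → ℝ) :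
    pderiv i (esShift Finset.univ 0 k) x = esShift {i}ᶜ 1 k x := by
  have hu : (Finset.univ : Finset (Fin N)) = insert i {i}ᶜ := by
    ext j
    simp
  have h1 : (fun t : ℝ => esShift Finset.univ 0 k (x + t • (Pi.single i 1 : Fin N → ℝ))) =
      fun t => esShift {i}ᶜ 0 k x + (x i + t) * esShift {i}ᶜ 1 k x := by
    ext t
    have hc : ∀ j ∈ ({i}ᶜ : Finset (Fin N)), (x + t • (Pi.single i 1 : Fin N → ℝ)) j = x j := by
      intro j hj
      have : j ≠ i := by simpa using hj
      simp [this]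
    rw [hu, esShift_insert (by simp), esShift_congr hc, esShift_congr hc]
    simp
  simp only [pderiv, lineDeriv]
  rw [h1]
  simp

/-- With `S` the complement of `J₂ ∪ {i, j}`, `esShift_insert` makes the difference of the two lower
operators equal to `(x_j - x_i)` times a symmetric polynomial in `S` of degree one less. -/
theorem opSet_esShift_univ (n : ℕ) : ∀ J : Finset (Fin N), J.card = n + 1 → ∀ (k : ℕ)
    (x : Fin N → ℝ), Function.Injective x →
      opSet J (esShift Finset.univ 0 k) x = esShift Jᶜ J.card k x := by
  induction n with
  | zero =>
    intro J hJ k x _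
    obtain ⟨i, rfl⟩ := Finset.card_eq_one.1 hJ
    simp [opSet, pderiv_esShift_univ]
  | succ n ih =>
    intro J hJ k x hx
    obtain ⟨i, J₁, hi, rfl, hJ₁⟩ := Finset.card_eq_succ.1 hJ
    obtain ⟨j, J₂, hj, rfl, hJ₂⟩ := Finset.card_eq_succ.1 hJ₁
    have hij : i ≠ j := fun h => hi (by simp [h])
    have hi2 : i ∉ J₂ := fun h => hi (by simp [h])
    have hci : (insert i J₂).card = n + 1 := by rw [Finset.card_insert_of_notMem hi2, hJ₂]
    have e1 : (insert i J₂)ᶜ = insert j (insert i (insert j J₂))ᶜ := by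
      ext m
      simp only [Finset.mem_compl, Finset.mem_insert]
      have : m = j → m ≠ i ∧ m ∉ J₂ := by
        rintro rfl
        exact ⟨hij.symm, hj⟩
      tauto
    have e2 : (insert j J₂)ᶜ = insert i (insert i (insert j J₂))ᶜ := by
      ext m
      simp only [Finset.mem_compl, Finset.mem_insert]
      have : m = i → m ≠ j ∧ m ∉ J₂ := by
        rintro rfl
        exact ⟨hij, hi2⟩
      tauto
    rw [opSet_insert_insert hij hi2 hj _ hx, ih _ hci k x hx, ih _ hJ₁ k x hx, e1, e2,
      esShift_insert (by simp), esShift_insert (by simp), hci, hJ₁, hJ]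
    rw [div_eq_iff (sub_ne_zero.2 (hx.ne hij.symm))]
    ring

/-- The vector along which `D_I` differentiates. -/
def opVec (I : Finset (Fin N)) (x : Fin N → ℝ) : Fin N → ℝ :=
  ∑ i ∈ I, (∏ j ∈ I.erase i, (x j - x i))⁻¹ • Pi.single i 1

/-- At each point `D_I` is a directional derivative, so the product and chain rules become
available. -/
theorem opSet_eq_fderiv (I : Finset (Fin N)) {φ : (Fin N → ℝ) → ℝ} {x : Fin N → ℝ}
    (h : DifferentiableAt ℝ φ x) : opSet I φ x = fderiv ℝ φ x (opVec I x) := by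
  rw [opVec, map_sum, opSet]
  refine Finset.sum_congr rfl fun i _ => ?_
  rw [map_smul, pderiv_eq_fderiv h, smul_eq_mul, div_eq_inv_mul]

theorem opSet_const_mul (I : Finset (Fin N)) {φ : (Fin N → ℝ) → ℝ} {x : Fin N → ℝ}
    (h : DifferentiableAt ℝ φ x) (c : ℝ) :
    opSet I (fun y => c * φ y) x = c * opSet I φ x := by
  rw [opSet_eq_fderiv I h, opSet_eq_fderiv I (h.const_mul c), fderiv_const_mul h]
  rfl

/-! ### The dual coordinates near the diagonal. -/

theorem eTilde_eq (h : ℕ) :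
    eTilde (N := N) h = fun x => ((N - h).factorial : ℝ) / (N.factorial : ℝ) *
      esShift Finset.univ 0 h x := by
  ext x
  simp [eTilde, esShift, MvPolynomial.esymm]

theorem eTilde_zero (x : Fin N → ℝ) : eTilde 0 x = 1 := by
  have : (N.factorial : ℝ) ≠ 0 := Nat.cast_ne_zero.2 N.factorial_ne_zero
  simp [eTilde, this]

theorem differentiable_eTilde (h : ℕ) : Differentiable ℝ (eTilde (N := N) h) := by
  rw [eTilde_eq]
  exact ((contDiff_esShift _ _ _ 1).differentiable (by simp)).const_mul _

theorem eTilde_diagPt {h : ℕ} (hh : h ≤ N) (a : ℝ) :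
    eTilde h (diagPt N a) = a ^ h / (h.factorial : ℝ) := by
  rw [eTilde_eq]
  simp only [esShift_diagPt, Nat.zero_le, if_true, Nat.sub_zero, Finset.card_univ,
    Fintype.card_fin]
  rw [Nat.cast_choose ℝ hh]
  have h1 : (N.factorial : ℝ) ≠ 0 := Nat.cast_ne_zero.2 N.factorial_ne_zero
  have h2 : ((N - h).factorial : ℝ) ≠ 0 := Nat.cast_ne_zero.2 (Nat.factorial_ne_zero _)
  field_simp

theorem coordU_eq_logCoeff (r : ℕ) (x : Fin N → ℝ) :
    coordU r x = logCoeff (fun h => eTilde h x) r := rfl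

/-- On the diagonal `ẽ_h = a^h / h!`, the coefficients of `exp (a X)`, whose logarithm is `a X`. -/
theorem coordU_diagPt (a : ℝ) : ∀ n < N, coordU (n + 1) (diagPt N a) = if n = 0 then a else 0 := by
  intro n
  induction n using Nat.strong_induction_on with
  | _ n ih =>
    intro hn
    have h1 := succ_mul_eq_sum_logCoeff (γ := fun h => eTilde h (diagPt N a)) (eTilde_zero _) n
    rw [Finset.Nat.sum_antidiagonal_eq_sum_range_succ_mk, Nat.succ_eq_add_one,
      Finset.sum_range_succ] at h1
    simp only [← coordU_eq_logCoeff, Nat.sub_self, eTilde_zero] at h1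
    rw [eTilde_diagPt (by omega), Finset.sum_congr rfl fun k hk => by
      rw [ih k (Finset.mem_range.1 hk) ((Finset.mem_range.1 hk).trans hn),
        eTilde_diagPt (by omega : n - k ≤ N)]] at h1
    have hn1 : ((n : ℝ) + 1) ≠ 0 := by positivity
    rw [Nat.factorial_succ] at h1
    push_cast at h1
    obtain _ | n := n
    · simpa using h1.symm
    · rw [Finset.sum_range_succ'] at h1
      have hf : (((n + 1).factorial : ℕ) : ℝ) ≠ 0 := Nat.cast_ne_zero.2 (Nat.factorial_ne_zero _)
      have h2 : (((n + 1 : ℕ) : ℝ) + 1) * (a ^ (n + 1 + 1) / ((((n + 1 : ℕ) : ℝ) + 1) *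
          ((n + 1).factorial : ℝ))) = a * (a ^ (n + 1) / ((n + 1).factorial : ℝ)) := by
        field_simp
        ring
      rw [h2] at h1
      simp at h1
      rw [if_neg (by omega)]
      have h3 : (((n + 1 : ℕ) : ℝ) + 1) ≠ 0 := by positivity
      push_cast at h3
      rcases h1 with h1 | h1
      · exact absurd h1 h3
      · exact h1

theorem differentiable_coordU (r : ℕ) : Differentiable ℝ (coordU (N := N) r) := by
  unfold coordU
  refine Differentiable.fun_sum fun σ _ => Differentiable.const_mul ?_ _
  induction σ.parts using Multiset.induction with
  | empty => simp
  | cons h s ih =>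
    simp only [Multiset.map_cons, Multiset.prod_cons]
    exact (differentiable_eTilde h).mul ih

/-- The limits are the coefficients of `c X^d exp (a X)` with `c = (N - d)!/N!`. -/
theorem tendsto_opSet_eTilde {d : ℕ} (hd : 1 ≤ d) (a : ℝ) {I : Finset (Fin N)} (hI : I.card = d)
    {r : ℕ} (hr : r ≤ N) :
    Tendsto (opSet I (eTilde r)) (𝓝[distinctPts N] diagPt N a)
      (𝓝 (((N - d).factorial : ℝ) / (N.factorial : ℝ) *
        if d ≤ r then a ^ (r - d) / ((r - d).factorial : ℝ) else 0)) := by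
  have hdN : d ≤ N := by
    have := Finset.card_le_univ I
    rwa [hI, Fintype.card_fin] at this
  have h1 := (((contDiff_esShift Iᶜ d r 0).continuous.tendsto (diagPt N a)).mono_left
    (nhdsWithin_le_nhds (s := distinctPts N))).const_mul
      (((N - r).factorial : ℝ) / (N.factorial : ℝ))
  have h2 : ((N - r).factorial : ℝ) / (N.factorial : ℝ) * esShift Iᶜ d r (diagPt N a) =
      ((N - d).factorial : ℝ) / (N.factorial : ℝ) *
        if d ≤ r then a ^ (r - d) / ((r - d).factorial : ℝ) else 0 := by
    rw [esShift_diagPt, Finset.card_compl, Fintype.card_fin, hI]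
    split_ifs with h
    · rw [Nat.cast_choose ℝ (by omega : r - d ≤ N - d), show N - d - (r - d) = N - r by omega]
      have h1 : (N.factorial : ℝ) ≠ 0 := Nat.cast_ne_zero.2 N.factorial_ne_zero
      have h2 : ((N - r).factorial : ℝ) ≠ 0 := Nat.cast_ne_zero.2 (Nat.factorial_ne_zero _)
      field_simp
    · simp
  rw [h2] at h1
  refine h1.congr' ?_
  filter_upwards [self_mem_nhdsWithin] with x hx
  obtain ⟨n, rfl⟩ := Nat.exists_eq_add_of_le' hd
  rw [eTilde_eq, opSet_const_mul I ((contDiff_esShift _ _ _ 1).differentiable (by simp) x),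
    opSet_esShift_univ n I hI r x hx, hI]

theorem opSet_eTilde_zero (I : Finset (Fin N)) (x : Fin N → ℝ) : opSet I (eTilde 0) x = 0 := by
  rw [opSet_eq_fderiv I (differentiable_eTilde 0 x)]
  have : eTilde (N := N) 0 = fun _ => 1 := funext eTilde_zero
  rw [this]
  simp

/-- Apply `D_I` to the recursion for the logarithm. The term `k = n` is isolated, since `ẽ_0 = 1` is
killed. -/
theorem opSet_coordU_succ (I : Finset (Fin N)) (n : ℕ) (x : Fin N → ℝ) :
    opSet I (coordU (n + 1)) x = opSet I (eTilde (n + 1)) x - (((n + 1 : ℕ) : ℝ))⁻¹ *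
      ∑ k ∈ Finset.range n, ((k + 1 : ℕ) : ℝ) *
        (coordU (k + 1) x * opSet I (eTilde (n - k)) x +
          eTilde (n - k) x * opSet I (coordU (k + 1)) x) := by
  have hfun : (fun y => ((n + 1 : ℕ) : ℝ) * eTilde (n + 1) y) = fun y : Fin N → ℝ =>
      ∑ k ∈ Finset.range (n + 1), ((k + 1 : ℕ) : ℝ) * (coordU (k + 1) y * eTilde (n - k) y) := by
    ext y
    have := succ_mul_eq_sum_logCoeff (γ := fun h => eTilde h y) (eTilde_zero _) n
    rw [Finset.Nat.sum_antidiagonal_eq_sum_range_succ_mk] at this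
    refine this.trans (Finset.sum_congr rfl fun k _ => ?_)
    rw [mul_assoc]
    rfl
  have hu : ∀ r, DifferentiableAt ℝ (coordU (N := N) r) x := fun r => differentiable_coordU r x
  have he : ∀ r, DifferentiableAt ℝ (eTilde (N := N) r) x := fun r => differentiable_eTilde r x
  have h1 := opSet_const_mul I (he (n + 1)) ((n + 1 : ℕ) : ℝ)
  have hD := HasFDerivAt.fun_sum (u := Finset.range (n + 1)) fun k _ =>
    (((hu (k + 1)).hasFDerivAt.mul (he (n - k)).hasFDerivAt).const_mul ((k + 1 : ℕ) : ℝ))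
  have h2 := opSet_eq_fderiv I hD.differentiableAt
  rw [hD.fderiv] at h2
  have h3 := h1.symm.trans ((congrArg (fun φ => opSet I φ x) hfun).trans h2)
  rw [sum_apply, Finset.sum_range_succ] at h3
  simp only [_root_.smul_apply, add_apply, smul_eq_mul, ← opSet_eq_fderiv I (hu _),
    ← opSet_eq_fderiv I (he _), Nat.sub_self, eTilde_zero, opSet_eTilde_zero] at h3
  have hn : ((n + 1 : ℕ) : ℝ) ≠ 0 := by positivity
  field_simp
  linear_combination -h3

/-- With `d = e + 1`: the coefficients of `c X^d` solve the limiting form of the recursion in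
`opSet_coordU_succ`. -/
theorem sum_range_diag_identity (a c : ℝ) (e n : ℕ) :
    (if n + 1 = e + 1 then c else 0) =
      c * (if e + 1 ≤ n + 1 then a ^ (n + 1 - (e + 1)) / ((n + 1 - (e + 1)).factorial : ℝ) else 0) -
        (((n + 1 : ℕ) : ℝ))⁻¹ * ∑ k ∈ Finset.range n, ((k + 1 : ℕ) : ℝ) *
          ((if k = 0 then a else 0) * (c * if e + 1 ≤ n - k then
              a ^ (n - k - (e + 1)) / ((n - k - (e + 1)).factorial : ℝ) else 0) +
            a ^ (n - k) / ((n - k).factorial : ℝ) * if k + 1 = e + 1 then c else 0) := by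
  have h1 : ∑ k ∈ Finset.range n, ((k + 1 : ℕ) : ℝ) *
          ((if k = 0 then a else 0) * (c * if e + 1 ≤ n - k then
              a ^ (n - k - (e + 1)) / ((n - k - (e + 1)).factorial : ℝ) else 0) +
            a ^ (n - k) / ((n - k).factorial : ℝ) * if k + 1 = e + 1 then c else 0) =
      (if e + 1 ≤ n then a * (c * (a ^ (n - (e + 1)) / ((n - (e + 1)).factorial : ℝ))) else 0) +
        if e < n then ((e + 1 : ℕ) : ℝ) * (a ^ (n - e) / ((n - e).factorial : ℝ) * c) else 0 := by
    simp only [mul_add, Finset.sum_add_distrib, ite_mul, mul_ite, zero_mul, mul_zero,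
      Finset.sum_ite_eq', Nat.add_right_cancel_iff, Finset.mem_range]
    congr 1
    by_cases hn : 0 < n
    · rw [Finset.sum_eq_single_of_mem 0 (Finset.mem_range.2 hn) fun k _ hk => by simp [hk]]
      simp
    · obtain rfl : n = 0 := by omega
      simp
  rw [h1]
  have hn1 : ((n + 1 : ℕ) : ℝ) ≠ 0 := by positivity
  rcases lt_trichotomy n e with h | rfl | h
  · simp [show ¬ n = e by omega, show ¬ e ≤ n by omega, show ¬ e + 1 ≤ n by omega,
      show ¬ e < n by omega]
  · simp
  · obtain ⟨m, rfl⟩ := Nat.exists_eq_add_of_lt h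
    rw [if_neg (by omega), if_pos (by omega), if_pos (by omega), if_pos (by omega),
      show e + m + 1 + 1 - (e + 1) = m + 1 by omega, show e + m + 1 - (e + 1) = m by omega,
      show e + m + 1 - e = m + 1 by omega, Nat.factorial_succ]
    have hm : (m.factorial : ℝ) ≠ 0 := Nat.cast_ne_zero.2 m.factorial_ne_zero
    push_cast at hn1 ⊢
    have hm1 : (m : ℝ) + 1 ≠ 0 := by positivity
    field_simp
    ring

/-- Formally `D_I (log F) = D_I F / F`, with limit `c X^d exp (a X) / exp (a X) = c X^d`. -/
theorem tendsto_opSet_coordU {d : ℕ} (hd : 1 ≤ d) (a : ℝ) {I : Finset (Fin N)}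
    (hI : I.card = d) : ∀ n < N, Tendsto (opSet I (coordU (n + 1))) (𝓝[distinctPts N] diagPt N a)
      (𝓝 (if n + 1 = d then ((N - d).factorial : ℝ) / (N.factorial : ℝ) else 0)) := by
  intro n
  induction n using Nat.strong_induction_on with
  | _ n ih =>
    intro hn
    set c : ℝ := ((N - d).factorial : ℝ) / (N.factorial : ℝ) with hc
    set w : ℕ → ℝ := fun r => if d ≤ r then a ^ (r - d) / ((r - d).factorial : ℝ) else 0 with hw
    have hlim : ∀ {φ : (Fin N → ℝ) → ℝ}, Differentiable ℝ φ →
        Tendsto φ (𝓝[distinctPts N] diagPt N a) (𝓝 (φ (diagPt N a))) := fun h =>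
      (h.continuous.tendsto _).mono_left nhdsWithin_le_nhds
    have hT : Tendsto (opSet I (coordU (n + 1))) (𝓝[distinctPts N] diagPt N a)
        (𝓝 (c * w (n + 1) - (((n + 1 : ℕ) : ℝ))⁻¹ * ∑ k ∈ Finset.range n, ((k + 1 : ℕ) : ℝ) *
          ((if k = 0 then a else 0) * (c * w (n - k)) +
            a ^ (n - k) / ((n - k).factorial : ℝ) * if k + 1 = d then c else 0))) := by
      rw [funext (opSet_coordU_succ I n)]
      refine (tendsto_opSet_eTilde hd a hI (by omega)).sub (Tendsto.const_mul _ ?_)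
      refine tendsto_finsetSum _ fun k hk => Tendsto.const_mul _ ?_
      have hk' := Finset.mem_range.1 hk
      have h1 := hlim (differentiable_coordU (N := N) (k + 1))
      rw [coordU_diagPt a k (by omega)] at h1
      have h2 := hlim (differentiable_eTilde (N := N) (n - k))
      rw [eTilde_diagPt (by omega)] at h2
      exact (h1.mul (tendsto_opSet_eTilde hd a hI (by omega))).add
        (h2.mul (ih k hk' (by omega)))
    obtain ⟨e, rfl⟩ := Nat.exists_eq_add_of_le' hd
    rw [sum_range_diag_identity a c e n]
    exact hT

/-- The normalization makes `D̂_d` the average of the `D_I`, as `d! (N - d)!/N!` is the inverse of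
`N.choose d`. -/
theorem tendsto_opDhat {d : ℕ} (hdN : d ≤ N) {φ : (Fin N → ℝ) → ℝ} {p : Fin N → ℝ} {L : ℝ}
    (h : ∀ I : Finset (Fin N), I.card = d → Tendsto (opSet I φ) (𝓝[distinctPts N] p) (𝓝 L)) :
    Tendsto (opDhat d φ) (𝓝[distinctPts N] p) (𝓝 L) := by
  have h1 : Tendsto (opDhat d φ) (𝓝[distinctPts N] p) (𝓝 (((N - d).factorial : ℝ) / N.factorial *
      ((d.factorial : ℝ) * ∑ I ∈ (Finset.univ : Finset (Fin N)).powersetCard d, L))) :=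
    ((tendsto_finsetSum _ fun I hI => h I (Finset.mem_powersetCard.1 hI).2).const_mul _).const_mul _
  convert h1 using 2
  rw [Finset.sum_const, Finset.card_powersetCard, Finset.card_univ, Fintype.card_fin,
    nsmul_eq_mul, Nat.cast_choose ℝ hdN]
  have h1 : (N.factorial : ℝ) ≠ 0 := Nat.cast_ne_zero.2 N.factorial_ne_zero
  have h2 : ((N - d).factorial : ℝ) ≠ 0 := Nat.cast_ne_zero.2 (Nat.factorial_ne_zero _)
  have h3 : (d.factorial : ℝ) ≠ 0 := Nat.cast_ne_zero.2 (Nat.factorial_ne_zero _)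
  field_simp

theorem differentiable_coordUhat (r : ℕ) : Differentiable ℝ (coordUhat (N := N) r) :=
  (differentiable_coordU r).const_mul _

theorem differentiable_coordMap : Differentiable ℝ (coordMap N) :=
  differentiable_pi.2 fun _ => differentiable_coordUhat _

theorem tendsto_opSet_coordUhat {d : ℕ} (hd : 1 ≤ d) (a : ℝ) {I : Finset (Fin N)}
    (hI : I.card = d) {n : ℕ} (hn : n < N) :
    Tendsto (opSet I (coordUhat (n + 1))) (𝓝[distinctPts N] diagPt N a)
      (𝓝 (if n + 1 = d then 1 else 0)) := by
  have h1 := (tendsto_opSet_coordU hd a hI n hn).const_mul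
    ((N.factorial : ℝ) / ((N - (n + 1)).factorial : ℝ))
  have h2 : opSet I (coordUhat (N := N) (n + 1)) = fun x =>
      ((N.factorial : ℝ) / ((N - (n + 1)).factorial : ℝ)) * opSet I (coordU (n + 1)) x :=
    funext fun x => opSet_const_mul I (differentiable_coordU _ x) _
  rw [h2]
  convert h1 using 2
  split_ifs with h
  · subst h
    have h1 : (N.factorial : ℝ) ≠ 0 := Nat.cast_ne_zero.2 N.factorial_ne_zero
    have h2 : ((N - (n + 1)).factorial : ℝ) ≠ 0 := Nat.cast_ne_zero.2 (Nat.factorial_ne_zero _)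
    field_simp
  · simp

theorem opSet_comp_coordMap (I : Finset (Fin N)) {ψ : (Fin N → ℝ) → ℝ} {x : Fin N → ℝ}
    (h : DifferentiableAt ℝ ψ (coordMap N x)) :
    opSet I (fun y => ψ (coordMap N y)) x =
      ∑ k : Fin N, pderiv k ψ (coordMap N x) * opSet I (coordUhat (k + 1)) x := by
  have hc := (differentiable_coordMap (N := N) x).hasFDerivAt
  have h1 := h.hasFDerivAt.comp x hc
  have h2 := opSet_eq_fderiv I h1.differentiableAt
  rw [h1.fderiv] at h2
  refine h2.trans ?_
  rw [ContinuousLinearMap.comp_apply, fderiv_eq_sum_pderiv h, sum_apply]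
  refine Finset.sum_congr rfl fun k _ => ?_
  rw [opSet_eq_fderiv I (differentiable_coordUhat _ x), _root_.smul_apply, smul_eq_mul]
  congr 1
  have h3 : HasFDerivAt (coordUhat (N := N) (k + 1))
      ((ContinuousLinearMap.proj k).comp (fderiv ℝ (coordMap N) x)) x :=
    hasFDerivAt_pi'.1 hc k
  rw [h3.fderiv]
  rfl

/-- In the chain rule all the factors `D_I û_r` tend to `0` except the one with `r = d`, which tends
to `1`. -/
theorem tendsto_opDhat_comp_coordMap {d : ℕ} (hd : 1 ≤ d) (hdN : d ≤ N) (a : ℝ)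
    {ψ : (Fin N → ℝ) → ℝ} (hψ : ContDiffAt ℝ 1 ψ (coordMap N (diagPt N a))) {k : Fin N}
    (hk : (k : ℕ) + 1 = d) :
    Tendsto (opDhat d fun y => ψ (coordMap N y)) (𝓝[distinctPts N] diagPt N a)
      (𝓝 (pderiv k ψ (coordMap N (diagPt N a)))) := by
  refine tendsto_opDhat hdN fun I hI => ?_
  have hev : ∀ᶠ y in 𝓝 (coordMap N (diagPt N a)), DifferentiableAt ℝ ψ y :=
    (hψ.eventually (by simp)).mono fun y hy => hy.differentiableAt (by simp)
  have hcm : Tendsto (coordMap N) (𝓝[distinctPts N] diagPt N a)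
      (𝓝 (coordMap N (diagPt N a))) :=
    (differentiable_coordMap.continuous.tendsto _).mono_left nhdsWithin_le_nhds
  have hpd : ∀ j, Tendsto (pderiv j ψ) (𝓝 (coordMap N (diagPt N a)))
      (𝓝 (pderiv j ψ (coordMap N (diagPt N a)))) := fun j => by
    have h1 : ContinuousAt (fun y => fderiv ℝ ψ y (Pi.single j 1)) (coordMap N (diagPt N a)) :=
      (hψ.fderiv_right (m := 0) (by simp)).continuousAt.clm_apply continuousAt_const
    rw [pderiv_eq_fderiv hev.self_of_nhds]
    refine h1.tendsto.congr' ?_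
    filter_upwards [hev] with y hy
    exact (pderiv_eq_fderiv hy j).symm
  have h1 : Tendsto (fun x => ∑ j : Fin N, pderiv j ψ (coordMap N x) *
      opSet I (coordUhat (j + 1)) x) (𝓝[distinctPts N] diagPt N a)
      (𝓝 (∑ j : Fin N, pderiv j ψ (coordMap N (diagPt N a)) *
        if (j : ℕ) + 1 = d then 1 else 0)) :=
    tendsto_finsetSum _ fun j _ =>
      ((hpd j).comp hcm).mul (tendsto_opSet_coordUhat hd a hI j.2)
  have h2 : ∑ j : Fin N, pderiv j ψ (coordMap N (diagPt N a)) *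
      (if (j : ℕ) + 1 = d then (1 : ℝ) else 0) = pderiv k ψ (coordMap N (diagPt N a)) := by
    rw [Finset.sum_eq_single k]
    · simp [hk]
    · intro j _ hj
      rw [if_neg, mul_zero]
      exact fun h => hj (Fin.ext (by omega))
    · simp
  rw [h2] at h1
  refine h1.congr' ?_
  filter_upwards [hcm.eventually hev] with x hx
  exact (opSet_comp_coordMap I hx).symm

/-- Uniqueness of limits needs the diagonal point to be approachable; the points `a + i/(n + 1)` do
so. -/
theorem neBot_nhdsWithin_distinctPts (a : ℝ) : (𝓝[distinctPts N] diagPt N a).NeBot := by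
  rw [← mem_closure_iff_nhdsWithin_neBot]
  have h1 : Tendsto (fun n : ℕ => fun i : Fin N => a + ((n : ℝ) + 1)⁻¹ * (i : ℝ)) atTop
      (𝓝 (diagPt N a)) := by
    refine tendsto_pi_nhds.2 fun i => ?_
    have := ((tendsto_one_div_add_atTop_nhds_zero_nat (𝕜 := ℝ)).mul_const (i : ℝ)).const_add a
    simpa [diagPt] using this
  refine mem_closure_of_tendsto h1 (Eventually.of_forall fun n i j hij => ?_)
  have hn : ((n : ℝ) + 1)⁻¹ ≠ 0 := by positivity
  simpa [hn, Fin.val_inj] using hij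

theorem hasValueAt_of_tendsto {d : ℕ} (hd : 1 ≤ d) (hdN : d ≤ N) {a v : ℝ}
    {φ : (Fin N → ℝ) → ℝ}
    (h : Tendsto (opDhat d φ) (𝓝[distinctPts N] diagPt N a) (𝓝 v)) :
    HasValueAt d φ (diagPt N a) v := by
  refine ⟨h, fun ψ hψ hφ k hk => ?_⟩
  have := neBot_nhdsWithin_distinctPts (N := N) a
  rw [funext hφ] at h
  exact tendsto_nhds_unique (tendsto_opDhat_comp_coordMap hd hdN a hψ hk) h

/-! ### From functions smooth near the diagonal point to globally smooth ones. -/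

theorem exists_contDiff_eventuallyEq {φ : (Fin N → ℝ) → ℝ} {n : ℕ} {a : ℝ} (hs : IsSymm φ)
    (hφ : ContDiffAt ℝ n φ (diagPt N a)) :
    ∃ φ' : (Fin N → ℝ) → ℝ, IsSymm φ' ∧ ContDiff ℝ n φ' ∧ φ =ᶠ[𝓝 (diagPt N a)] φ' := by
  have hev : ∀ᶠ x in 𝓝 (diagPt N a), ContDiffAt ℝ n φ x := hφ.eventually (by simp)
  obtain ⟨ε, hε, hball⟩ := Metric.eventually_nhds_iff_ball.1 hev
  -- A product of one bump per coordinate is symmetric. In the sup metric, a point outside the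
  -- `ε`-ball has a coordinate farther than `ε / 2` from `a`, so the cutoff vanishes near it.
  let b : ContDiffBump a := ⟨ε / 4, ε / 2, by positivity, by linarith⟩
  have hb : ContDiff ℝ n fun x : Fin N → ℝ => ∏ i, b (x i) :=
    contDiff_prod fun i _ => b.contDiff.comp (contDiff_apply ℝ ℝ i)
  refine ⟨fun x => (∏ i, b (x i)) * φ x, fun s x => ?_, contDiff_iff_contDiffAt.2 fun x => ?_, ?_⟩
  · simp only [hs s x]
    congr 1
    exact Equiv.prod_comp s fun i => b (x i)
  · by_cases hx : x ∈ Metric.ball (diagPt N a) ε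
    · exact hb.contDiffAt.mul (hball x hx)
    · obtain ⟨i, hi⟩ : ∃ i, ε / 2 < dist (x i) a := by
        by_contra! hc
        refine hx (lt_of_le_of_lt ((dist_pi_le_iff (by positivity)).2 hc) ?_)
        linarith
      have hz : (fun x => (∏ i, b (x i)) * φ x) =ᶠ[𝓝 x] fun _ => 0 := by
        have hc : ContinuousAt (fun y : Fin N → ℝ => dist (y i) a) x :=
          ((continuous_apply i).dist continuous_const).continuousAt
        filter_upwards [hc.eventually (lt_mem_nhds hi)] with y hy
        rw [Finset.prod_eq_zero (Finset.mem_univ i) (b.zero_of_le_dist hy.le), zero_mul]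
      exact contDiffAt_const.congr_of_eventuallyEq hz
  · filter_upwards [Metric.ball_mem_nhds (diagPt N a) (by positivity : 0 < ε / 4)] with x hx
    have h1 : ∏ i, b (x i) = 1 := Finset.prod_eq_one fun i _ =>
      b.one_of_mem_closedBall ((dist_le_pi_dist x (diagPt N a) i).trans (Metric.mem_ball.1 hx).le)
    rw [h1, one_mul]

theorem mixedPderiv_congr {φ φ' : (Fin N → ℝ) → ℝ} {p : Fin N → ℝ} (h : φ =ᶠ[𝓝 p] φ')
    (m : Fin N → ℕ) : mixedPderiv m φ p = mixedPderiv m φ' p := by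
  rw [mixedPderiv_eq_listDeriv, mixedPderiv_eq_listDeriv]
  exact (listDeriv_congr _ h).self_of_nhds

theorem opSet_congr (I : Finset (Fin N)) {φ φ' : (Fin N → ℝ) → ℝ} {p : Fin N → ℝ}
    (h : φ =ᶠ[𝓝 p] φ') : opSet I φ =ᶠ[𝓝 p] opSet I φ' := by
  have h1 : ∀ᶠ x in 𝓝 p, ∀ i, pderiv i φ x = pderiv i φ' x :=
    eventually_all.2 fun i => pderiv_congr h i
  filter_upwards [h1] with x hx
  simp only [opSet, hx]

theorem hasValueAt_diagDeriv {d : ℕ} (hd : 1 ≤ d) (hdN : d ≤ N) {a : ℝ} {φ : (Fin N → ℝ) → ℝ}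
    (hs : IsSymm φ) (hφ : ContDiffAt ℝ d φ (diagPt N a)) :
    HasValueAt d φ (diagPt N a) (diagDeriv d φ (diagPt N a)) := by
  obtain ⟨φ', hs', hφ', he⟩ := exists_contDiff_eventuallyEq hs hφ
  have hD : diagDeriv d φ (diagPt N a) = diagDeriv d φ' (diagPt N a) := by
    simp only [diagDeriv, partitionDeriv, mixedPderiv_congr he]
  refine hasValueAt_of_tendsto hd hdN (tendsto_opDhat hdN fun I hI => ?_)
  rw [hD]
  exact (tendsto_opSet_diagDeriv hd hdN hs' hφ' a hI).congr'
    ((opSet_congr I he).symm.filter_mono nhdsWithin_le_nhds)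

/-! ### Trace functions. -/

theorem pderiv_comp_apply (g : ℝ → ℝ) (j k : Fin N) :
    pderiv k (fun x => g (x j)) = if k = j then fun x => deriv g (x j) else fun _ => 0 := by
  ext x
  simp only [pderiv, lineDeriv]
  split_ifs with h
  · subst h
    simp [deriv_comp_const_add]
  · simp [Ne.symm h]

theorem listDeriv_comp_apply (g : ℝ → ℝ) (j : Fin N) (l : List (Fin N)) :
    listDeriv l (fun x => g (x j)) =
      if ∀ k ∈ l, k = j then fun x => iteratedDeriv l.length g (x j) else fun _ => 0 := by
  induction l with
  | nil => simp
  | cons k l ih =>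
    rw [listDeriv_cons, ih]
    by_cases hl : ∀ i ∈ l, i = j
    · rw [if_pos hl, pderiv_comp_apply]
      simp only [List.forall_mem_cons, and_iff_left hl, iteratedDeriv_succ, List.length_cons]
    · rw [if_neg hl, if_neg fun h => hl (List.forall_mem_cons.1 h).2]
      ext x
      simp [pderiv, lineDeriv]

/-- The first derivative applied leaves a function of `x_j` alone, which any other variable
annihilates. -/
theorem listDeriv_concat_traceFun (f : ℝ → ℝ) (l : List (Fin N)) (j : Fin N) :
    listDeriv (l ++ [j]) (traceFun N f) =
      if ∀ k ∈ l, k = j then fun x => iteratedDeriv (l.length + 1) f (x j) else fun _ => 0 := by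
  rw [listDeriv_append, listDeriv_cons, listDeriv_nil, pderiv_traceFun, listDeriv_comp_apply]
  simp only [← iteratedDeriv_succ']

theorem Realizes.parts_eq {d : ℕ} {h : Fin N → ℕ} {σ : d.Partition} (hr : Realizes h σ) :
    σ.parts = (Finset.univ.filter fun i => h i ≠ 0).val.map h := by
  rw [← hr, Multiset.filter_map]
  rfl

theorem partitionDeriv_traceFun {d : ℕ} (hd : 1 ≤ d) (hdN : d ≤ N) (f : ℝ → ℝ) (a : ℝ)
    (σ : d.Partition) : partitionDeriv σ (traceFun N f) (diagPt N a) =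
      if σ = Nat.Partition.indiscrete d then iteratedDeriv d f a else 0 := by
  have hr := realizes_stdMult hdN σ
  have hlen := length_multList_stdMult hdN σ
  have hmem : ∀ k, stdMult N σ k ≠ 0 ↔ k ∈ multList (stdMult N σ) := fun k => by
    rw [← count_multList (stdMult N σ) k, ← List.count_pos_iff, Nat.pos_iff_ne_zero]
  rw [partitionDeriv, mixedPderiv_eq_listDeriv]
  obtain h | ⟨l, j, h⟩ := List.eq_nil_or_concat (multList (stdMult N σ))
  · rw [h, List.length_nil] at hlen
    omega
  · rw [List.concat_eq_append] at h
    rw [h] at hmem hlen ⊢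
    have hl : l.length + 1 = d := by simpa using hlen
    -- All the derivatives fall on one variable exactly when `σ` has a single part.
    have hiff : (∀ k ∈ l, k = j) ↔ σ = Nat.Partition.indiscrete d := by
      constructor
      · intro hk
        have hf : (Finset.univ.filter fun i => stdMult N σ i ≠ 0) = {j} := by
          ext i
          simp only [Finset.mem_filter, Finset.mem_univ, true_and, hmem, List.mem_append,
            List.mem_singleton, Finset.mem_singleton]
          exact ⟨fun h => h.elim (hk i) id, Or.inr⟩
        have hp := hr.parts_eq
        rw [hf, Finset.singleton_val, Multiset.map_singleton] at hp
        have hs := σ.parts_sum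
        rw [hp, Multiset.sum_singleton] at hs
        refine Nat.Partition.ext ?_
        rw [hp, hs, Nat.Partition.indiscrete_parts (by omega)]
      · rintro rfl k hk
        have hp := congrArg Multiset.card hr.parts_eq
        rw [Nat.Partition.indiscrete_parts (by omega), Multiset.card_singleton, Multiset.card_map,
          ← Finset.card_def, eq_comm, Finset.card_eq_one] at hp
        obtain ⟨m, hm⟩ := hp
        have hm' : ∀ i, i ∈ l ++ [j] → i = m := fun i hi => by
          rw [← Finset.mem_singleton, ← hm]
          simpa using (hmem i).2 hi
        rw [hm' k (by simp [hk]), hm' j (by simp)]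
    rw [listDeriv_concat_traceFun]
    simp only [hiff, hl]
    split_ifs <;> rfl

theorem partitionCoeff_indiscrete {d : ℕ} (hd : 1 ≤ d) :
    partitionCoeff (Nat.Partition.indiscrete d) = (-1) ^ (d - 1) / ((d - 1).factorial : ℝ) := by
  obtain ⟨e, rfl⟩ := Nat.exists_eq_add_of_le' hd
  rw [partitionCoeff, Finset.prod_eq_single_of_mem (e + 1) (by simp)]
  · rw [Nat.Partition.indiscrete_parts (by omega)]
    have h1 : (e.factorial : ℝ) ≠ 0 := Nat.cast_ne_zero.2 e.factorial_ne_zero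
    have h2 : (e : ℝ) + 1 ≠ 0 := by positivity
    simp only [Multiset.card_singleton, Multiset.count_singleton_self, Nat.add_sub_cancel,
      Nat.sub_self, Nat.factorial_zero, Nat.factorial_succ, pow_one]
    push_cast
    field_simp
  · intro h _ hh
    simp [Nat.Partition.indiscrete_parts, hh]

theorem isSymm_traceFun (f : ℝ → ℝ) : IsSymm (traceFun N f) := fun s x =>
  Equiv.sum_comp s fun i => f (x i)

theorem contDiffAt_traceFun {f : ℝ → ℝ} {n : WithTop ℕ∞} {a : ℝ} (hf : ContDiffAt ℝ n f a) :
    ContDiffAt ℝ n (traceFun N f) (diagPt N a) :=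
  ContDiffAt.sum fun i _ => ContDiffAt.comp (diagPt N a) hf (contDiff_apply ℝ ℝ i).contDiffAt

theorem diagDeriv_traceFun {d : ℕ} (hd : 1 ≤ d) (hdN : d ≤ N) (f : ℝ → ℝ) (a : ℝ) :
    diagDeriv d (traceFun N f) (diagPt N a) =
      (-1) ^ (d - 1) / ((d - 1).factorial : ℝ) * iteratedDeriv d f a := by
  simp [diagDeriv, partitionDeriv_traceFun hd hdN, partitionCoeff_indiscrete hd]

end SymmDeriv

end

theorem corollary3p9 (N d : ℕ) (hd : 1 ≤ d) (hdN : d ≤ N) (a : ℝ) :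
    (∀ φ : (Fin N → ℝ) → ℝ, SymmDeriv.IsSymm φ →
      ContDiffAt ℝ d φ (SymmDeriv.diagPt N a) →
        (∀ (σ : d.Partition) (h : Fin N → ℕ), SymmDeriv.Realizes h σ →
          SymmDeriv.mixedPderiv h φ (SymmDeriv.diagPt N a) =
            SymmDeriv.partitionDeriv σ φ (SymmDeriv.diagPt N a)) ∧
        SymmDeriv.HasValueAt d φ (SymmDeriv.diagPt N a)
          (SymmDeriv.diagDeriv d φ (SymmDeriv.diagPt N a))) ∧
    (∀ f : ℝ → ℝ, ContDiffAt ℝ d f a →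
      SymmDeriv.HasValueAt d (SymmDeriv.traceFun N f) (SymmDeriv.diagPt N a)
        ((-1) ^ (d - 1) / ((d - 1).factorial : ℝ) * iteratedDeriv d f a)) := by
  refine ⟨fun φ hs hφ => ⟨fun σ h hr => ?_, SymmDeriv.hasValueAt_diagDeriv hd hdN hs hφ⟩,
    fun f hf => ?_⟩
  -- Independence of the indices is proved for globally smooth functions; both sides depend only on
  -- the germ of `φ`.
  · obtain ⟨φ', hs', hφ', he⟩ := SymmDeriv.exists_contDiff_eventuallyEq hs hφ
    rw [SymmDeriv.partitionDeriv, SymmDeriv.mixedPderiv_congr he, SymmDeriv.mixedPderiv_congr he]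
    exact SymmDeriv.mixedPderiv_diagPt_eq hdN hs' hφ' hr a
  · rw [← SymmDeriv.diagDeriv_traceFun hd hdN f a]
    exact SymmDeriv.hasValueAt_diagDeriv hd hdN (SymmDeriv.isSymm_traceFun f)
      (SymmDeriv.contDiffAt_traceFun hf)
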